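/- **Setting.** Let $n\ge 2$ and let $T_A\ge T_B\ge 0$ be integers. In the discrete pure-count Blotto game on $n$ battlefields, player $P\in\{A,B\}$ chooses a random vector $X_P\in\mathbb{Z}_{\ge 0}^n$ (a mixed strategy) with $\sum_i X_{P,i}\le T_P$ almost surely; in the associated Lotto game only $\sum_i \mathbb{E}[X_{P,i}]\le T_P$ is required. The two players randomize independently. In both games a player receives $1$ for each battlefield on which her allocation is strictly larger, $1/2$ for each battlefield with equal allocations, and $0$ otherwise; payoffs are expectations. A strategy is optimal if it maximizes the expected payoff that it guarantees against all strategies of the opponent. Put $a=T_A/n$, $b=T_B/n$, $m=\lfloor a\rfloor$, $\alpha=a-m$, $\beta=b-m$. Let $U_e^m=\mathsf{Unif}\{0,2,\dots,2m\}$, let $U_o^m=\mathsf{Unif}\{1,3,\dots,2m-1\}$ (for $m\ge1$), and let $U_{o/e}^{m,t}=(1-t)U_e^m+tU_o^m$ for $t\in[0,1]$ (with $t=0$ if $m=0$). For $s,t\in[0,1]$ ($s=t=0$ if $m=0$), define Hart's Lotto marginals $\mu_A=\mu_A^s$ and $\mu_B=\mu_B^t$ by the table 1. $a=b=m$: $\mu_A=U_{o/e}^{m,s}$,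 $\mu_B=U_{o/e}^{m,t}$; 2. $b<a=m$: $\mu_A=U_o^m$, $\mu_B=(1-\frac bm)\delta_0+\frac bm U_{o/e}^{m,t}$; 3. $m<b\le a<m+1$: $\mu_A=(1-\alpha)U_e^m+\alpha U_o^{m+1}$, $\mu_B=(1-\beta)U_e^m+\beta U_o^{m+1}$; 4. $b=m<a<m+1$: $\mu_A=(1-\alpha)U_{o/e}^{m,s}+\alpha U_o^{m+1}$, $\mu_B=U_e^m$; 5. $b<m<a<m+1$: $\mu_A=(1-\alpha)U_o^m+\alpha U_o^{m+1}$, $\mu_B=(1-\frac bm)\delta_0+\frac bm U_e^m$. **Theorem.** Assume that $T_B$ is even, that $T_A$ and $n$ have the same parity, and that $2\lfloor T_A/n\rfloor\le T_B$. Then: (i) For all admissible $s,t$: if all coordinates of $X_A$ have law $\mu_A^s$ and all coordinates of $X_B$ have law $\mu_B^t$, then $X_A$ and $X_B$ are optimal and form a Nash equilibrium in the Lotto game. If such an $X_A$ (resp. $X_B$) is a strategy of the Blotto game, then it is optimal there; and if both are, they form a Nash equilibrium of the Blotto game. (ii) The marginals can be coupled into optimal strategies of the Blotto game. For every admissible $s$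 there is an $X_A$, optimal in the Blotto game, with all coordinates of law $\mu_A^s$ and $\sum_iX_{A,i}=T_A$ almost surely. For every admissible $t$, with $t\le\frac{m}{2m+1}$ if $T_B<T_A$ (a restriction that matters in case 2 only), there is an $X_B$, optimal in the Blotto game, with all coordinates of law $\mu_B^t$ and $\sum_iX_{B,i}=T_B$ almost surely. (iii) These strategies can be constructed algorithmically: there are two computable functions (one for each player) which, from $n,T_A,T_B$ satisfying the above and from integers $p\ge0$, $q\ge1$ such that $p/q$ is a weight allowed in (ii), compute a nonempty finite list of vectors in $\mathbb{Z}_{\ge0}^n$ (possibly with repetitions) such that drawing an entry of the list uniformly at random is a strategy $X_A$ (resp. $X_B$) as in (ii) with $s=p/q$ (resp. $t=p/q$). -/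

import Mathlib

open scoped ENNReal

noncomputable section

namespace DiscreteBlotto

/-! The discrete pure-count Blotto and Lotto games. -/

/-- Probability of winning a battlefield with `x` units against `y` units: the larger force wins,
equal forces win with probability `1/2`. -/
def win (x y : ℕ) : ℝ≥0∞ := if y < x then 1 else if x = y then 2⁻¹ else 0

/-- Payoff of the allocation `x` against the allocation `y`: every battlefield has value `1`. -/
def payoff {n : ℕ} (x y : Fin n → ℕ) : ℝ≥0∞ := ∑ i, win (x i) (y i)

/-- A mixed strategy: a probability distribution over allocation vectors of nonnegative integers. -/
abbrev Strategy (n : ℕ) : Type := PMF (Fin n → ℕ)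

/-- Expected payoff of (the player using) `σ` when the opponent independently uses `τ`. It is always
a finite number, at most `n`, and `expPayoff σ τ + expPayoff τ σ = n`. -/
def expPayoff {n : ℕ} (σ τ : Strategy n) : ℝ≥0∞ := ∑' x, ∑' y, σ x * τ y * payoff x y

/-- Strategies of the Blotto game with budget `T`: the budget constraint holds almost surely. -/
def blotto (n T : ℕ) : Set (Strategy n) := {σ | ∀ x ∈ σ.support, ∑ i, x i ≤ T}

/-- Strategies of the Lotto game with budget `T`: the budget constraint holds in expectation. -/
def lotto (n T : ℕ) : Set (Strategy n) := {σ | ∑ i, ∑' x, σ x * (x i : ℝ≥0∞) ≤ (T : ℝ≥0∞)}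

/-- `σ` is an optimal (maximin) strategy for a player with strategy set `S` whose opponent has
strategy set `S'`: it maximizes the guaranteed expected payoff. -/
def IsOptimal {n : ℕ} (S S' : Set (Strategy n)) (σ : Strategy n) : Prop :=
  σ ∈ S ∧ ∀ σ' ∈ S, (⨅ τ ∈ S', expPayoff σ' τ) ≤ ⨅ τ ∈ S', expPayoff σ τ

/-- `(σ, τ)` is a Nash equilibrium of the game with strategy sets `S` and `S'`. -/
def IsNash {n : ℕ} (S S' : Set (Strategy n)) (σ τ : Strategy n) : Prop :=
  σ ∈ S ∧ τ ∈ S' ∧ (∀ σ' ∈ S, expPayoff σ' τ ≤ expPayoff σ τ) ∧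
    ∀ τ' ∈ S', expPayoff τ' σ ≤ expPayoff τ σ

/-- Each of the `n` coordinates of `σ` has probability mass function `μ`. -/
def HasMarginals {n : ℕ} (σ : Strategy n) (μ : ℕ → ℝ) : Prop :=
  ∀ (i : Fin n) (k : ℕ), (σ.map (fun x => x i) k).toReal = μ k

/-- `σ` is a coupling of `n` copies of `μ` whose sum is almost surely equal to `T`
(a joint mix, when `T` is `n` times the mean of `μ`). -/
def IsJointMix {n : ℕ} (T : ℕ) (μ : ℕ → ℝ) (σ : Strategy n) : Prop :=
  HasMarginals σ μ ∧ ∀ x ∈ σ.support, ∑ i, x i = T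

/-! Probability mass functions on `ℕ` and the table of optimal Lotto marginals. -/

/-- Uniform distribution on `{0, 2, …, 2m}`. -/
def unifEven (m : ℕ) (k : ℕ) : ℝ := if Even k ∧ k ≤ 2 * m then 1 / ((m : ℝ) + 1) else 0

/-- Uniform distribution on `{1, 3, …, 2m - 1}`, for `m ≥ 1`. -/
def unifOdd (m : ℕ) (k : ℕ) : ℝ := if Odd k ∧ k < 2 * m then 1 / (m : ℝ) else 0

/-- The mixture `(1 - t) μ + t ν`. -/
def mix (t : ℝ) (μ ν : ℕ → ℝ) (k : ℕ) : ℝ := (1 - t) * μ k + t * ν k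

/-- The point mass at `0`. -/
def dirac0 (k : ℕ) : ℝ := if k = 0 then 1 else 0

/-- Admissible weights of the odd part in a mixture of `unifEven m` and `unifOdd m`
(for `m = 0` there is no odd part). -/
def IsWeight (m : ℕ) (t : ℝ) : Prop := 0 ≤ t ∧ t ≤ 1 ∧ (m = 0 → t = 0)

/-- Optimal marginals of the player with the larger budget `TA`. With `a = TA / n`, `b = TB / n`,
`m = ⌊a⌋` and `α = a - m`, the cases are, in this order:
`a = b = m`; `b < a = m`; `m < b ≤ a < m + 1`; `b = m < a < m + 1`; `b < m < a < m + 1`.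
The parameter `s` is the free weight of the odd part, in the cases where there is one. -/
def lottoA (n TA TB : ℕ) (s : ℝ) : ℕ → ℝ :=
  let m := TA / n
  let α : ℝ := (TA : ℝ) / n - m
  if TA = m * n then
    if TB = TA then mix s (unifEven m) (unifOdd m)
    else unifOdd m
  else if m * n < TB then mix α (unifEven m) (unifOdd (m + 1))
  else if TB = m * n then mix α (mix s (unifEven m) (unifOdd m)) (unifOdd (m + 1))
  else mix α (unifOdd m) (unifOdd (m + 1))

/-- Optimal marginals of the player with the smaller budget `TB`, in the same five cases;
`β = b - m`. The parameter `t` is the free weight of the odd part, where there is one. -/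
def lottoB (n TA TB : ℕ) (t : ℝ) : ℕ → ℝ :=
  let m := TA / n
  let b : ℝ := (TB : ℝ) / n
  if TA = m * n then
    if TB = TA then mix t (unifEven m) (unifOdd m)
    else mix (b / m) dirac0 (mix t (unifEven m) (unifOdd m))
  else if m * n < TB then mix (b - m) (unifEven m) (unifOdd (m + 1))
  else if TB = m * n then unifEven m
  else mix (b / m) dirac0 (unifEven m)

/-! Strategies given by explicit finite data. -/

/-- The strategy that draws an entry of the nonempty list `L` uniformly at random (repetitions
count); an entry is the list of the allocations to the battlefields `0, …, n - 1`. -/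
def ofList (n : ℕ) (L : List (List ℕ)) (hL : L ≠ []) : Strategy n :=
  PMF.ofMultiset (L.map fun l (i : Fin n) => l.getD i 0 : List (Fin n → ℕ)) (by simpa using hL)

/-- The list `L` of allocation vectors of length `n`, drawn from uniformly, is a joint mix of `n`
copies of `μ` with sum `T`. -/
def ListIsJointMix (n T : ℕ) (μ : ℕ → ℝ) (L : List (List ℕ)) : Prop :=
  (∀ l ∈ L, l.length = n) ∧ ∃ hL : L ≠ [], IsJointMix T μ (ofList n L hL)

end DiscreteBlotto

end

namespace DiscreteBlotto

open Finset

/-! ### Averages of empirical measures of multisets with prescribed size and sum -/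

/-! Two independent arguments are combined: an affine bound that settles the games, and a
combinatorial construction of couplings with constant sum.

Games. With ties counted as one half, `x` units beat a uniform even number from `0, …, 2m` with
probability at most `(x + 1) / (2 (m + 1))`, and a uniform odd number below `2m` with probability at
most `x / (2m)`. Hence against every marginal of the table the winning probability is at most some
`c + d x`, and the payoff against any coupling of it is at most `n c + d T` for an opponent of
expected budget `T`. In each row the two bounds add up to `n` (`Admissible.exists_affineBound`), the
constant sum of the game, so any two such couplings form a saddle point. Blotto strategies are Lotto
strategies, so the bounds persist in the Blotto game; optimality there of one coupling only needs
some coupling of the opponent's marginals inside the Blotto game.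

Couplings. If `n μ` is a convex combination of counting measures of `n`-element multisets with sum
`T` (the set `mixes n T`), then drawing such a multiset and rotating its entries couples `n` copies
of `μ` with sum `T` (`RatMix.exists_list`). Members of `mixes` can be added, averaged, transformed
affinely, and shifted by one in a given number of entries. The building blocks are antithetic pairs
(`pair_mem_mixes`), triples of progressions (`triple_mem_mixes`), and partitions in which all
nonzero part sizes are equally frequent on average (`flat_mem_mixes`). Large numbers of copies split
into pairs, so the remaining difficulty is one block of three or four entries, dictated by parity.
The flat partitions give the marginals with an atom at `0`; they need `2m ≤ TB`.

Algorithms. Convex combinations are taken over `ℚ`, so a coupling is a uniform draw from a finite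
list. Whether a list is suitable is a primitive recursive question, and a search through all lists
stops because a suitable one exists. -/

/-- The counting measure of a multiset of integers. -/
noncomputable def emp (s : Multiset ℤ) : ℤ →₀ ℚ := (s.map fun x => Finsupp.single x 1).sum

/-- Convex combinations of counting measures of multisets with `n` elements and sum `T`. -/
def mixes (n : ℕ) (T : ℤ) : Set (ℤ →₀ ℚ) :=
  convexHull ℚ {c | ∃ s : Multiset ℤ, s.card = n ∧ s.sum = T ∧ emp s = c}

theorem emp_zero : emp 0 = 0 := by simp [emp]

theorem emp_cons (x : ℤ) (s : Multiset ℤ) : emp (x ::ₘ s) = Finsupp.single x 1 + emp s := by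
  simp [emp]

theorem emp_add (s t : Multiset ℤ) : emp (s + t) = emp s + emp t := by simp [emp]

theorem mapDomain_emp (f : ℤ → ℤ) (s : Multiset ℤ) :
    Finsupp.mapDomain f (emp s) = emp (s.map f) := by
  induction s using Multiset.induction with
  | empty => simp [emp_zero]
  | cons x s ih => simp [emp_cons, Finsupp.mapDomain_add, ih]

theorem convex_mixes (n : ℕ) (T : ℤ) : Convex ℚ (mixes n T) := convex_convexHull _ _

theorem emp_mem_mixes {s : Multiset ℤ} {n : ℕ} {T : ℤ} (hn : s.card = n) (hT : s.sum = T) :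
    emp s ∈ mixes n T := subset_convexHull _ _ ⟨s, hn, hT, rfl⟩

theorem zero_mem_mixes : (0 : ℤ →₀ ℚ) ∈ mixes 0 0 := by
  rw [← emp_zero]; exact emp_mem_mixes rfl rfl

theorem single_mem_mixes (x : ℤ) : Finsupp.single x 1 ∈ mixes 1 x := by
  have : emp {x} = Finsupp.single x 1 := by simp [emp]
  rw [← this]; exact emp_mem_mixes (by simp) (by simp)

theorem mixes_congr {c d : ℤ →₀ ℚ} {n k : ℕ} {T U : ℤ} (hc : c ∈ mixes n T) (hcd : c = d)
    (hnk : n = k) (hTU : T = U) : d ∈ mixes k U := by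
  subst hcd hnk hTU; exact hc

open scoped Pointwise in
theorem add_mem_mixes {c d : ℤ →₀ ℚ} {n k : ℕ} {T U : ℤ} (hc : c ∈ mixes n T)
    (hd : d ∈ mixes k U) : c + d ∈ mixes (n + k) (T + U) := by
  have h : c + d ∈ mixes n T + mixes k U := Set.add_mem_add hc hd
  rw [mixes, mixes, ← convexHull_add] at h
  refine convexHull_mono ?_ h
  rintro _ ⟨_, ⟨s, hs, hs', rfl⟩, _, ⟨t, ht, ht', rfl⟩, rfl⟩
  exact ⟨s + t, by simp [hs, ht], by simp [hs', ht'], emp_add s t⟩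

theorem nsmul_mem_mixes {c : ℤ →₀ ℚ} {n : ℕ} {T : ℤ} (hc : c ∈ mixes n T) (j : ℕ) :
    (j : ℚ) • c ∈ mixes (j * n) (j * T) := by
  induction j with
  | zero => simpa using zero_mem_mixes
  | succ j ih =>
    have := add_mem_mixes ih hc
    exact mixes_congr this (by push_cast; module) (by ring) (by push_cast; ring)

/-- A linear map sending counting measures into `mixes k U` sends `mixes n T` there. -/
theorem linear_mem_mixes (F : (ℤ →₀ ℚ) →ₗ[ℚ] (ℤ →₀ ℚ)) {n k : ℕ} {T U : ℤ}
    (h : ∀ s : Multiset ℤ, s.card = n → s.sum = T → F (emp s) ∈ mixes k U)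
    {c : ℤ →₀ ℚ} (hc : c ∈ mixes n T) : F c ∈ mixes k U := by
  have : mixes n T ⊆ F ⁻¹' mixes k U := by
    refine convexHull_min ?_ ((convex_mixes k U).linear_preimage F)
    rintro _ ⟨s, hs, hs', rfl⟩
    exact h s hs hs'
  exact this hc

theorem mapDomain_mem_mixes (u v : ℤ) {n : ℕ} {T : ℤ} {c : ℤ →₀ ℚ} (hc : c ∈ mixes n T) :
    Finsupp.mapDomain (fun x => u * x + v) c ∈ mixes n (u * T + n * v) := by
  refine linear_mem_mixes (Finsupp.lmapDomain ℚ ℚ fun x => u * x + v) ?_ hc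
  intro s hs hs'
  rw [Finsupp.lmapDomain_apply, mapDomain_emp]
  refine emp_mem_mixes (by simpa using hs) ?_
  rw [Multiset.sum_map_add, Multiset.sum_map_mul_left]
  simp [hs, hs']

theorem combo_mem_mixes {n : ℕ} {T : ℤ} {c d : ℤ →₀ ℚ} (hc : c ∈ mixes n T) (hd : d ∈ mixes n T)
    {θ : ℚ} (h0 : 0 ≤ θ) (h1 : θ ≤ 1) : (1 - θ) • c + θ • d ∈ mixes n T :=
  convex_mixes n T hc hd (by linarith) h0 (by ring)

/-- Raise a uniformly random set of `r` entries by one: every outcome has sum `s.sum + r`, and each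
entry is raised with probability `r / s.card`. The induction splits according to whether the head is
raised. -/
theorem emp_shift_mem_mixes (s : Multiset ℤ) (r : ℕ) (hr : r ≤ s.card) :
    (1 - (r : ℚ) / s.card) • emp s + ((r : ℚ) / s.card) • emp (s.map (· + 1)) ∈
      mixes s.card (s.sum + r) := by
  induction s using Multiset.induction generalizing r with
  | empty => simp at hr; subst hr; simpa [emp_zero] using zero_mem_mixes
  | cons x s ih =>
    rw [Multiset.card_cons] at hr
    simp only [Multiset.card_cons, Multiset.sum_cons, Multiset.map_cons, emp_cons]
    have hn : ((s.card + 1 : ℕ) : ℚ) ≠ 0 := by positivity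
    have keep : r ≤ s.card → Finsupp.single x 1 + ((1 - (r : ℚ) / s.card) • emp s +
        ((r : ℚ) / s.card) • emp (s.map (· + 1))) ∈ mixes (s.card + 1) (x + s.sum + r) := by
      intro h
      have := add_mem_mixes (single_mem_mixes x) (ih r h)
      rwa [add_comm 1, ← add_assoc] at this
    have up : ∀ r', r = r' + 1 → Finsupp.single (x + 1) 1 + ((1 - (r' : ℚ) / s.card) • emp s +
        ((r' : ℚ) / s.card) • emp (s.map (· + 1))) ∈ mixes (s.card + 1) (x + s.sum + r) := by
      rintro r' rfl
      have := add_mem_mixes (single_mem_mixes (x + 1)) (ih r' (by omega))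
      convert this using 2
      · omega
      · push_cast; ring
    rcases Nat.eq_zero_or_pos r with rfl | hr0
    · simpa using keep (Nat.zero_le _)
    obtain ⟨r', rfl⟩ := Nat.exists_eq_succ_of_ne_zero hr0.ne'
    have hu := up r' rfl
    -- If `r` is the full size, the head has to be raised and `keep` is not available.
    rcases Nat.lt_or_ge s.card (r' + 1) with h | h
    · have hr' : r' = s.card := by omega
      subst hr'
      have e : (((s.card).succ : ℕ) : ℚ) / ((s.card + 1 : ℕ) : ℚ) = 1 := by
        rw [Nat.succ_eq_add_one]; field_simp
      rw [e]
      rcases Nat.eq_zero_or_pos s.card with h0 | h0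
      · rw [Multiset.card_eq_zero] at h0
        subst h0
        simpa [emp_zero] using hu
      · have : (s.card : ℚ) ≠ 0 := by positivity
        rw [div_self this] at hu
        simpa using hu
    · have hk := keep h
      have hs : (s.card : ℚ) ≠ 0 := by
        have : 0 < s.card := by omega
        positivity
      -- The head belongs to a random `r`-subset with probability `r / (s.card + 1)`.
      have := combo_mem_mixes hk hu (θ := ((r' + 1 : ℕ) : ℚ) / ((s.card + 1 : ℕ) : ℚ))
        (by positivity) (by rw [div_le_one (by positivity)]; exact_mod_cast hr)
      convert this using 1
      rw [Nat.succ_eq_add_one]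
      generalize emp (s.map (· + 1)) = B
      generalize emp s = A
      generalize Finsupp.single (x + 1) (1 : ℚ) = β
      generalize Finsupp.single x (1 : ℚ) = α
      push_cast
      match_scalars <;> field_simp <;> ring

theorem shift_mem_mixes {n : ℕ} {T : ℤ} {c : ℤ →₀ ℚ} (hc : c ∈ mixes n T) {r : ℕ} (hr : r ≤ n) :
    (1 - (r : ℚ) / n) • c + ((r : ℚ) / n) • Finsupp.mapDomain (· + 1) c ∈ mixes n (T + r) := by
  refine linear_mem_mixes ((1 - (r : ℚ) / n) • LinearMap.id +
    ((r : ℚ) / n) • Finsupp.lmapDomain ℚ ℚ (· + 1)) ?_ hc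
  rintro s rfl rfl
  have := emp_shift_mem_mixes s r hr
  rw [← mapDomain_emp] at this
  simpa using this

/-! ### Uniform measures on arithmetic progressions -/

/-- The counting measure of the progression `a, a + d, …` with `N` terms. -/
noncomputable def prog (a d : ℤ) (N : ℕ) : ℤ →₀ ℚ :=
  ∑ i ∈ range N, Finsupp.single (a + d * i) 1

/-- The uniform distribution on the progression `a, a + d, …` with `N` terms. -/
noncomputable def unif (a d : ℤ) (N : ℕ) : ℤ →₀ ℚ := (N : ℚ)⁻¹ • prog a d N

theorem prog_add (a d : ℤ) (M N : ℕ) :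
    prog a d (M + N) = prog a d M + prog (a + d * M) d N := by
  rw [prog, prog, prog, sum_range_add]
  congr 1
  refine sum_congr rfl fun i _ => ?_
  push_cast; congr 1; ring

theorem prog_one (a d : ℤ) : prog a d 1 = Finsupp.single a 1 := by simp [prog]

theorem prog_succ (a d : ℤ) (N : ℕ) :
    prog a d (N + 1) = Finsupp.single a 1 + prog (a + d) d N := by
  rw [add_comm, prog_add, prog_one]; simp

theorem prog_succ' (a d : ℤ) (N : ℕ) :
    prog a d (N + 1) = prog a d N + Finsupp.single (a + d * N) 1 := by
  rw [prog_add, prog_one]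

theorem mapDomain_prog (u v a d : ℤ) (N : ℕ) :
    Finsupp.mapDomain (fun x => u * x + v) (prog a d N) = prog (u * a + v) (u * d) N := by
  simp only [prog, Finsupp.mapDomain_finsetSum, Finsupp.mapDomain_single]
  refine sum_congr rfl fun i _ => ?_
  congr 1; ring

theorem mapDomain_unif (u v a d : ℤ) (N : ℕ) :
    Finsupp.mapDomain (fun x => u * x + v) (unif a d N) = unif (u * a + v) (u * d) N := by
  rw [unif, Finsupp.mapDomain_smul, mapDomain_prog, unif]

theorem prog_neg (a d : ℤ) (N : ℕ) : prog (a + d * N) (-d) (N + 1) = prog a d (N + 1) := by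
  rw [prog, prog, ← sum_range_reflect]
  refine sum_congr rfl fun i hi => ?_
  rw [mem_range] at hi
  have : ((N + 1 - 1 - i : ℕ) : ℤ) = N - i := by omega
  rw [this]; congr 1; ring

theorem sum_mem_mixes {n : ℕ} {T : ℤ} {N : ℕ} (hN : N ≠ 0) (f : ℕ → ℤ →₀ ℚ)
    (hf : ∀ i < N, f i ∈ mixes n T) : (N : ℚ)⁻¹ • ∑ i ∈ range N, f i ∈ mixes n T := by
  rw [smul_sum]
  refine (convex_mixes n T).sum_mem (fun i _ => by positivity) ?_ fun i hi => hf i (mem_range.1 hi)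
  simp [hN]

/-- Antithetic coupling: one entry climbs its progression while the other descends, so the sum stays
fixed. -/
theorem pair_mem_mixes (b c d : ℤ) (q : ℕ) :
    unif b d (q + 1) + unif c d (q + 1) ∈ mixes 2 (b + c + d * q) := by
  have h := sum_mem_mixes (n := 2) (T := b + c + d * q) (Nat.succ_ne_zero q)
    (fun j => Finsupp.single (b + d * j) 1 + Finsupp.single (c + d * q + (-d) * j) 1)
    (fun j _ => by
      have := add_mem_mixes (single_mem_mixes (b + d * j)) (single_mem_mixes (c + d * q + (-d) * j))
      convert this using 2; ring)
  rw [sum_add_distrib, smul_add] at h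
  rw [unif, unif, ← prog_neg c]
  exact h

theorem unif_even_mem_mixes (a d : ℤ) (q j : ℕ) :
    ((2 * j : ℕ) : ℚ) • unif a d (q + 1) ∈ mixes (2 * j) (j * (2 * a + d * q)) := by
  have := nsmul_mem_mixes (pair_mem_mixes a a d q) j
  exact mixes_congr this (by push_cast; module) (by ring) (by ring)

/-- Three uniform progressions, the longest with as many steps as the others together. -/
theorem triple_mem_mixes (a b d : ℤ) (N : ℕ) : ∀ (c : ℤ) (p q : ℕ), p + q = N →
    unif a d (p + 1) + unif b d (q + 1) + unif c d (p + q + 1) ∈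
      mixes 3 (a + b + c + d * (p + q)) := by
  induction N with
  | zero =>
    intro c p q h
    obtain ⟨rfl, rfl⟩ : p = 0 ∧ q = 0 := by omega
    simp only [unif, prog, zero_add, Nat.cast_one, inv_one, one_smul, sum_range_one, Nat.cast_zero,
      mul_zero, add_zero]
    exact add_mem_mixes (add_mem_mixes (single_mem_mixes a) (single_mem_mixes b)) (single_mem_mixes c)
  | succ N ih =>
    intro c p q h
    rcases Nat.eq_zero_or_pos p with rfl | hp
    · have := add_mem_mixes (single_mem_mixes a) (pair_mem_mixes b c d q)
      refine mixes_congr this ?_ rfl (by push_cast; ring)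
      simp only [zero_add, unif, prog_one, Nat.cast_one, inv_one, one_smul]; abel
    rcases Nat.eq_zero_or_pos q with rfl | hq
    · have := add_mem_mixes (single_mem_mixes b) (pair_mem_mixes a c d p)
      refine mixes_congr this ?_ rfl (by push_cast; ring)
      simp only [zero_add, add_zero, unif, prog_one, Nat.cast_one, inv_one, one_smul]; abel
    obtain ⟨p, rfl⟩ := Nat.exists_eq_succ_of_ne_zero hp.ne'
    obtain ⟨q, rfl⟩ := Nat.exists_eq_succ_of_ne_zero hq.ne'
    -- The long progression sits at its first term exactly when the two short ones sit at their last
    -- terms. Otherwise it is uniform on its remaining terms, and one of the short progressions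
    -- loses its last term; these are the two induction hypotheses.
    have h0 : Finsupp.single (a + d * (p + 1 : ℕ)) 1 + Finsupp.single (b + d * (q + 1 : ℕ)) 1 +
        Finsupp.single c 1 ∈ mixes 3 (a + b + c + d * ((p + 1 : ℕ) + (q + 1 : ℕ))) := by
      have := add_mem_mixes (add_mem_mixes (single_mem_mixes (a + d * (p + 1 : ℕ)))
        (single_mem_mixes (b + d * (q + 1 : ℕ)))) (single_mem_mixes c)
      convert this using 2; ring
    have h1 := ih (c + d) p (q + 1) (by omega)
    have h2 := ih (c + d) (p + 1) q (by omega)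
    have e1 : a + b + (c + d) + d * ((p : ℤ) + (q + 1 : ℕ)) =
      a + b + c + d * ((p + 1 : ℕ) + (q + 1 : ℕ)) := by push_cast; ring
    have e2 : a + b + (c + d) + d * (((p + 1 : ℕ) : ℤ) + q) =
      a + b + c + d * ((p + 1 : ℕ) + (q + 1 : ℕ)) := by push_cast; ring
    rw [e1] at h1
    rw [e2] at h2
    -- The weight `1 / (p + q + 3)` is the mass of one term of the long progression. The first
    -- progression keeps its last term in `h2`, the second in `h1`; the weights `(q + 1) / (p + q +
    -- 2)` and `(p + 1) / (p + q + 2)` bring both last terms to the uniform mass.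
    have key := combo_mem_mixes (combo_mem_mixes h1 h2 (θ := (q + 1 : ℚ) / (p + q + 2))
      (by positivity) (by rw [div_le_one (by positivity)]; linarith [(Nat.cast_nonneg p : (0:ℚ) ≤ p)]))
      h0 (θ := 1 / (p + q + 3)) (by positivity)
      (by rw [div_le_one (by positivity)]
          linarith [(Nat.cast_nonneg p : (0:ℚ) ≤ p), (Nat.cast_nonneg q : (0:ℚ) ≤ q)])
    convert key using 1
    have x1 : p + (q + 1) + 1 = p + q + 2 := by ring
    have x2 : p + 1 + q + 1 = p + q + 2 := by ring
    have x3 : p + 1 + (q + 1) + 1 = p + q + 2 + 1 := by ring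
    simp only [Nat.succ_eq_add_one, x1, x2, x3, unif, prog_succ' a d (p + 1), prog_succ' b d (q + 1),
      prog_succ c d (p + q + 2)]
    generalize prog a d (p + 1) = A
    generalize prog b d (q + 1) = B
    generalize prog (c + d) d (p + q + 2) = C
    generalize Finsupp.single (a + d * (p + 1 : ℕ)) (1 : ℚ) = α
    generalize Finsupp.single (b + d * (q + 1 : ℕ)) (1 : ℚ) = β
    generalize Finsupp.single c (1 : ℚ) = γ
    push_cast
    have hp : (0 : ℚ) ≤ p := by positivity
    have hq : (0 : ℚ) ≤ q := by positivity
    match_scalars <;> field_simp <;> ring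

/-! ### Uniform part sizes -/

theorem linear_eq_of_mem_mixes (F : (ℤ →₀ ℚ) →ₗ[ℚ] ℚ) {n : ℕ} {T : ℤ} {v : ℚ}
    (h : ∀ s : Multiset ℤ, s.card = n → s.sum = T → F (emp s) = v)
    {c : ℤ →₀ ℚ} (hc : c ∈ mixes n T) : F c = v := by
  have : mixes n T ⊆ {c | F c = v} := by
    refine convexHull_min ?_ (convex_hyperplane F.isLinear v)
    rintro _ ⟨s, hs, hs', rfl⟩
    exact h s hs hs'
  exact this hc

/-- The total mass of a measure. -/
noncomputable def mass : (ℤ →₀ ℚ) →ₗ[ℚ] ℚ := Finsupp.linearCombination ℚ fun _ => (1 : ℚ)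

/-- The first moment of a measure. -/
noncomputable def moment : (ℤ →₀ ℚ) →ₗ[ℚ] ℚ := Finsupp.linearCombination ℚ fun x => (x : ℚ)

theorem mass_single (x : ℤ) : mass (Finsupp.single x 1) = 1 := by simp [mass]

theorem moment_single (x : ℤ) : moment (Finsupp.single x 1) = x := by simp [moment]

theorem mass_of_mem_mixes {n : ℕ} {T : ℤ} {c : ℤ →₀ ℚ} (hc : c ∈ mixes n T) : mass c = n := by
  refine linear_eq_of_mem_mixes mass ?_ hc
  rintro s rfl -
  simp [emp, map_multiset_sum, mass_single]

theorem moment_of_mem_mixes {n : ℕ} {T : ℤ} {c : ℤ →₀ ℚ} (hc : c ∈ mixes n T) :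
    moment c = T := by
  refine linear_eq_of_mem_mixes moment ?_ hc
  rintro s - rfl
  clear hc
  induction s using Multiset.induction with
  | empty => simp [emp_zero]
  | cons x s ih =>
    rw [emp_cons, map_add, ih, moment_single, Multiset.sum_cons, Int.cast_add]

theorem mass_prog (a d : ℤ) (N : ℕ) : mass (prog a d N) = N := by
  simp [prog, mass_single]

theorem moment_prog_one (M : ℕ) : moment (prog 1 1 M) = M * (M + 1) / 2 := by
  induction M with
  | zero => simp [prog]
  | succ M ih => rw [prog_succ', map_add, ih, moment_single]; push_cast; ring

/-- Some partitions of `T` into at most `n` parts of size at most `M` have all part sizes equally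
often on average. -/
def FlatMix (M n : ℕ) (T : ℤ) : Prop :=
  ∃ z q : ℚ, z • Finsupp.single 0 1 + q • prog 1 1 M ∈ mixes n T

theorem FlatMix.add {M n k : ℕ} {T U : ℤ} (h : FlatMix M n T) (h' : FlatMix M k U) :
    FlatMix M (n + k) (T + U) := by
  obtain ⟨z, q, h⟩ := h
  obtain ⟨z', q', h'⟩ := h'
  exact ⟨z + z', q + q', mixes_congr (add_mem_mixes h h') (by module) rfl rfl⟩

theorem FlatMix.nsmul {M n : ℕ} {T : ℤ} (h : FlatMix M n T) (j : ℕ) :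
    FlatMix M (j * n) (j * T) := by
  obtain ⟨z, q, h⟩ := h
  exact ⟨j * z, j * q, mixes_congr (nsmul_mem_mixes h j) (by module) rfl rfl⟩

theorem flatMix_zeros (M j : ℕ) : FlatMix M j 0 := by
  have h : FlatMix M 1 0 := ⟨1, 0, by simpa using single_mem_mixes 0⟩
  simpa using h.nsmul j

theorem flatMix_pair (M : ℕ) : FlatMix M 2 M := by
  have h := pair_mem_mixes 0 0 1 M
  refine ⟨2 * (M + 1 : ℚ)⁻¹, 2 * (M + 1 : ℚ)⁻¹, mixes_congr h ?_ rfl (by ring)⟩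
  rw [unif, prog_succ, zero_add]
  push_cast; module

/-- Two measures that are constant on `1, …, ρ` and on `ρ + 1, …, ρ + N` can be balanced. -/
theorem flatMix_of_balance {ρ N n : ℕ} {T : ℤ} {z l h z' l' h' : ℚ}
    (hc : z • Finsupp.single 0 1 + l • prog 1 1 ρ + h • prog (ρ + 1) 1 N ∈ mixes n T)
    (hd : z' • Finsupp.single 0 1 + l' • prog 1 1 ρ + h' • prog (ρ + 1) 1 N ∈ mixes n T)
    (h1 : l < h) (h2 : h' ≤ l') : FlatMix (ρ + N) n T := by
  have hD : 0 < (h - l) + (l' - h') := by linarith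
  -- The difference between the lower and the upper density is affine in `θ`, negative at `0` and
  -- nonnegative at `1`; `θ` is its zero.
  obtain ⟨θ, h0, h1, e⟩ : ∃ θ : ℚ, 0 ≤ θ ∧ θ ≤ 1 ∧ (1 - θ) * l + θ * l' = (1 - θ) * h + θ * h' := by
    refine ⟨(h - l) / ((h - l) + (l' - h')), div_nonneg (by linarith) hD.le, ?_, ?_⟩
    · rw [div_le_one hD]; linarith
    · have := hD.ne'
      field_simp
      ring
  refine ⟨(1 - θ) * z + θ * z', (1 - θ) * l + θ * l',
    mixes_congr (combo_mem_mixes hc hd h0 h1) ?_ rfl rfl⟩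
  rw [prog_add, smul_add, one_mul, add_comm (1 : ℤ)]
  linear_combination (norm := module) (-e) • prog (ρ + 1) 1 N

/-- Parts from two copies of the upper interval. -/
theorem upper_mem_mixes (ρ N : ℕ) :
    (0 : ℚ) • Finsupp.single 0 1 + (0 : ℚ) • prog 1 1 ρ + (2 * (N + 1 : ℚ)⁻¹) • prog (ρ + 1) 1 (N + 1)
      ∈ mixes 2 (ρ + (N + 1) + ρ + 1) := by
  refine mixes_congr (pair_mem_mixes (ρ + 1) (ρ + 1) 1 N) ?_ rfl (by ring)
  rw [unif]; push_cast; module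

/-- With `M = ρ + N + 1`, one extreme is a zero and an antithetic pair on `ρ + 1, …, M`, which
avoids the lower sizes. The other is a triple uniform on `0, …, ρ`, on `ρ + 1, …, M` and on `1, …,
M`; it favours the lower sizes as long as the lower interval `0, …, ρ` is not longer than the upper
one, which is `ρ ≤ N`. -/
theorem flatMix_three {ρ N : ℕ} (h : ρ ≤ N) : FlatMix (ρ + (N + 1)) 3 (ρ + (N + 1) + ρ + 1) := by
  have h1 := add_mem_mixes (single_mem_mixes 0) (upper_mem_mixes ρ N)
  have h2 := triple_mem_mixes 0 (ρ + 1) 1 (ρ + N) 1 ρ N rfl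
  refine flatMix_of_balance (z := 1) (l := 0) (h := 2 * (N + 1 : ℚ)⁻¹) (z' := (ρ + 1 : ℚ)⁻¹)
    (l' := (ρ + 1 : ℚ)⁻¹ + (ρ + N + 1 : ℚ)⁻¹) (h' := (N + 1 : ℚ)⁻¹ + (ρ + N + 1 : ℚ)⁻¹)
    (mixes_congr h1 ?_ (by norm_num) (by ring)) (mixes_congr h2 ?_ rfl (by ring)) (by positivity) ?_
  · module
  · rw [unif, unif, unif, prog_succ, add_assoc ρ N 1, prog_add 1 1 ρ (N + 1), zero_add, one_mul,
      add_comm (1 : ℤ)]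
    push_cast
    rw [← add_assoc (ρ : ℚ)]
    module
  · have : (ρ : ℚ) ≤ N := by exact_mod_cast h
    gcongr

/-- A fourth entry removes the condition `ρ ≤ N`: a pair on `0, …, ρ` and a pair on `1, …, M` always
favour the lower sizes. -/
theorem flatMix_four (ρ N : ℕ) : FlatMix (ρ + (N + 1)) 4 (ρ + (N + 1) + ρ + 1) := by
  have h1 := add_mem_mixes (add_mem_mixes (single_mem_mixes 0) (single_mem_mixes 0))
    (upper_mem_mixes ρ N)
  have h2 := add_mem_mixes (pair_mem_mixes 0 0 1 ρ) (pair_mem_mixes 1 1 1 (ρ + N))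
  refine flatMix_of_balance (z := 2) (l := 0) (h := 2 * (N + 1 : ℚ)⁻¹) (z' := 2 * (ρ + 1 : ℚ)⁻¹)
    (l' := 2 * (ρ + 1 : ℚ)⁻¹ + 2 * (ρ + N + 1 : ℚ)⁻¹) (h' := 2 * (ρ + N + 1 : ℚ)⁻¹)
    (mixes_congr h1 ?_ (by norm_num) (by ring)) (mixes_congr h2 ?_ rfl (by push_cast; ring))
    (by positivity) ?_
  · module
  · rw [unif, unif, prog_succ, add_assoc ρ N 1, prog_add 1 1 ρ (N + 1), zero_add, one_mul,
      add_comm (1 : ℤ)]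
    push_cast
    rw [← add_assoc (ρ : ℚ)]
    module
  · have : (0 : ℚ) ≤ 2 * (ρ + 1 : ℚ)⁻¹ := by positivity
    linarith

/-- Write `T = M j + r`. Pairs with sum `M` account for `j - 1` of the multiples of `M`, one block
of two, three or four entries has sum `M + r`, and zeros fill the rest. The bound `2 T ≤ n M`
provides the number of entries required. -/
theorem flatMix {n M T : ℕ} (hM : 1 ≤ M) (h1 : M ≤ T) (h2 : 2 * T ≤ n * M) : FlatMix M n T := by
  obtain ⟨j, r, hr, rfl⟩ : ∃ j r, r < M ∧ T = M * j + r :=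
    ⟨T / M, T % M, Nat.mod_lt _ hM, (Nat.div_add_mod T M).symm⟩
  -- This is where `M ≤ T` enters: the remainder `r` shares its block with one full `M`.
  have hj : 1 ≤ j := by
    by_contra h
    obtain rfl : j = 0 := by omega
    omega
  have base : ∀ k U : ℕ, FlatMix M k U → 2 * (j - 1) + k ≤ n → M * (j - 1) + U = M * j + r →
      FlatMix M n (M * j + r : ℕ) := by
    intro k U h hk hU
    have := (((flatMix_pair M).nsmul (j - 1)).add h).add (flatMix_zeros M (n - (2 * (j - 1) + k)))
    rw [← hU]
    convert this using 1
    · omega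
    · push_cast; ring
  obtain ⟨j, rfl⟩ := Nat.exists_eq_add_of_le' hj
  simp only [Nat.add_sub_cancel] at base
  rcases Nat.eq_zero_or_pos r with rfl | hr0
  · refine base 2 M (flatMix_pair M) ?_ (by ring)
    have : 2 * (j + 1) ≤ n := by nlinarith
    omega
  obtain ⟨ρ, rfl⟩ := Nat.exists_eq_add_of_le' hr0
  obtain ⟨N, rfl⟩ : ∃ N, M = ρ + (N + 1) := ⟨M - ρ - 1, by omega⟩
  by_cases hρ : ρ ≤ N
  · refine base 3 (ρ + (N + 1) + ρ + 1) (by exact_mod_cast flatMix_three hρ) ?_ (by ring)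
    have : 2 * j + 2 < n := by nlinarith
    omega
  · refine base 4 (ρ + (N + 1) + ρ + 1) (by exact_mod_cast flatMix_four ρ N) ?_ (by ring)
    -- Here `r = ρ + 1` exceeds `M / 2`, so `2 T ≤ n M` leaves room for the fourth entry.
    have : 2 * j + 3 < n := by nlinarith
    omega

/-- Total mass `n` and first moment `T` determine the two coefficients left open in `FlatMix`. -/
theorem flat_mem_mixes {n M T : ℕ} (hM : 1 ≤ M) (h1 : M ≤ T) (h2 : 2 * T ≤ n * M) :
    ((n : ℚ) - 2 * T / (M + 1)) • Finsupp.single 0 1 + (2 * T / (M * (M + 1)) : ℚ) • prog 1 1 M ∈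
      mixes n T := by
  obtain ⟨z, q, h⟩ := flatMix hM h1 h2
  have e1 := mass_of_mem_mixes h
  have e2 := moment_of_mem_mixes h
  rw [map_add, map_smul, map_smul, mass_single, mass_prog] at e1
  rw [map_add, map_smul, map_smul, moment_single, moment_prog_one] at e2
  simp only [smul_eq_mul, Int.cast_zero, mul_zero, zero_add, mul_one, Int.cast_natCast] at e1 e2
  have hM' : (M : ℚ) ≠ 0 := by positivity
  have hM1 : (M : ℚ) + 1 ≠ 0 := by positivity
  have hq : q = 2 * T / (M * (M + 1)) := by field_simp; linarith
  have hz : z = n - 2 * T / (M + 1) := by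
    rw [← e1, hq]; field_simp; ring
  rwa [← hq, ← hz]

/-! ### Sums of uniform progressions -/

/-- The extreme case `2 T = n M` of the flat partitions, in which `0` becomes as frequent as every
other size. -/
theorem three_unif_mem_mixes (k : ℕ) : (3 : ℚ) • unif 0 1 (2 * k + 1) ∈ mixes 3 (3 * k) := by
  rcases Nat.eq_zero_or_pos k with rfl | hk
  · simpa [unif, prog_one] using nsmul_mem_mixes (single_mem_mixes 0) 3
  have h := flat_mem_mixes (n := 3) (M := 2 * k) (T := 3 * k) (by omega) (by omega) (by omega)
  refine mixes_congr h ?_ rfl (by push_cast; ring)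
  rw [unif, prog_succ, zero_add]
  have : (k : ℚ) ≠ 0 := by positivity
  push_cast
  match_scalars <;> field_simp <;> ring

/-- Antithetic pairs suffice for even `n`. For odd `n` one block of three is split off, which needs
an odd number of terms. -/
theorem unif_mem_mixes {n p : ℕ} {a d T : ℤ} (hn : n ≠ 1) (h : Even n ∨ Even p)
    (hT : 2 * T = n * (2 * a + d * p)) : (n : ℚ) • unif a d (p + 1) ∈ mixes n T := by
  rcases Nat.even_or_odd' n with ⟨j, rfl | rfl⟩
  · exact mixes_congr (unif_even_mem_mixes a d p j) rfl rfl (by push_cast at hT; linarith)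
  · obtain ⟨k, rfl⟩ : ∃ k, p = 2 * k := by
      rcases h with h | ⟨k, hk⟩
      · exact absurd h (by simp)
      · exact ⟨k, by omega⟩
    obtain ⟨i, rfl⟩ : ∃ i, j = i + 1 := ⟨j - 1, by omega⟩
    have h3 := mapDomain_mem_mixes d a (three_unif_mem_mixes k)
    rw [Finsupp.mapDomain_smul, mapDomain_unif, mul_zero, zero_add, mul_one] at h3
    refine mixes_congr (add_mem_mixes h3 (unif_even_mem_mixes a d (2 * k) i)) ?_ (by ring) ?_
    · push_cast; module
    · push_cast at hT ⊢; linarith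

/-- A uniform interval with an even number of terms is the average of its halves. -/
theorem unif_halves (a d : ℤ) (k : ℕ) : unif a d (k + 1) + unif (a + d * (k + 1)) d (k + 1) =
    (2 : ℚ) • unif a d (2 * k + 2) := by
  have : 2 * k + 2 = (k + 1) + (k + 1) := by ring
  rw [unif, unif, unif, this, prog_add a d (k + 1) (k + 1)]
  push_cast
  match_scalars <;> field_simp <;> norm_num

/-- The two halves of the long interval are the short progressions of a triple whose third member is
the interval `0, …, 2k`. -/
theorem unif_long_long_short_mem_mixes (k : ℕ) :
    (2 : ℚ) • unif 0 1 (2 * k + 2) + unif 0 1 (2 * k + 1) ∈ mixes 3 (3 * k + 1) := by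
  have h := triple_mem_mixes 0 (0 + 1 * (k + 1)) 1 (k + k) 0 k k rfl
  rw [unif_halves] at h
  exact mixes_congr h (by rw [two_mul]) rfl (by ring)

/-- The long interval consists of the inner points `1, …, 2k + 1` and the endpoints `0` and `2k +
2`. On the inner points the triple with the two halves of the short interval applies. The upper
endpoint is joined with a pair on the lower half, the lower endpoint with a pair on the upper half.
-/
theorem unif_short_short_long_mem_mixes (k : ℕ) :
    (2 : ℚ) • unif 0 1 (2 * k + 2) + unif 0 1 (2 * k + 3) ∈ mixes 3 (3 * k + 2) := by
  have h1 := triple_mem_mixes 0 (0 + 1 * (k + 1)) 1 (k + k) 1 k k rfl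
  have h2 := add_mem_mixes (pair_mem_mixes 0 0 1 k) (single_mem_mixes (2 * k + 2))
  have h3 := add_mem_mixes (pair_mem_mixes (0 + 1 * (k + 1)) (0 + 1 * (k + 1)) 1 k)
    (single_mem_mixes 0)
  rw [unif_halves] at h1
  have h23 := combo_mem_mixes (mixes_congr h2 rfl rfl (U := 3 * k + 2) (by ring))
    (mixes_congr h3 rfl rfl (by ring)) (θ := 1 / 2) (by norm_num) (by norm_num)
  -- The two endpoints carry mass `2 / (2k + 3)` of the long interval.
  have h := combo_mem_mixes (mixes_congr h1 rfl rfl (by ring)) h23 (θ := 2 / (2 * k + 3))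
    (by positivity) (by rw [div_le_one (by positivity)]; linarith [(Nat.cast_nonneg k : (0:ℚ) ≤ k)])
  refine mixes_congr h ?_ rfl rfl
  rw [show (1 - (1 / 2 : ℚ)) • (unif 0 1 (k + 1) + unif 0 1 (k + 1) + Finsupp.single ((2 : ℤ) * k + 2) (1 : ℚ)) +
    (1 / 2 : ℚ) • (unif (0 + 1 * (k + 1)) 1 (k + 1) + unif (0 + 1 * (k + 1)) 1 (k + 1) +
      Finsupp.single 0 1) = (unif 0 1 (k + 1) + unif (0 + 1 * (k + 1)) 1 (k + 1)) +
      (1 / 2 : ℚ) • (Finsupp.single 0 1 + Finsupp.single ((2 : ℤ) * k + 2) (1 : ℚ)) by module, unif_halves]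
  rw [show unif 0 1 (2 * k + 3) = (2 * k + 3 : ℚ)⁻¹ • (Finsupp.single 0 1 + (prog 1 1 (k + k + 1) +
    Finsupp.single ((2 : ℤ) * k + 2) (1 : ℚ))) by
      rw [unif, show 2 * k + 3 = k + k + 1 + 1 + 1 by ring, prog_succ, zero_add, prog_succ']
      push_cast
      rw [show (k + k + 1 + 1 + 1 : ℚ) = 2 * k + 3 by ring,
        show (1 : ℤ) + 1 * (k + k + 1) = 2 * k + 2 by ring]]
  rw [unif.eq_def 1]
  push_cast
  match_scalars <;> field_simp <;> ring

/-- Integrality of `T` forces the copies with an even number of terms to be even in number. The two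
families can then be treated separately, unless the other family has a single member; that one is
put into a block of three with two copies from the even family. -/
theorem unif_consecutive_mem_mixes {x y p : ℕ} {T : ℤ} (hxy : 2 ≤ x + y)
    (hT : 2 * T = p * x + (p + 1) * y) :
    (x : ℚ) • unif 0 1 (p + 1) + (y : ℚ) • unif 0 1 (p + 2) ∈ mixes (x + y) T := by
  have split : ∀ {x y : ℕ} {T : ℤ}, x ≠ 1 → y ≠ 1 → (Even x ∨ Even p) → (Even y ∨ Even (p + 1)) →
      2 * T = p * x + (p + 1) * y →
      (x : ℚ) • unif 0 1 (p + 1) + (y : ℚ) • unif 0 1 (p + 2) ∈ mixes (x + y) T := by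
    intro x y T hx hy hx' hy' hT
    have ex : Even ((x : ℤ) * p) := by
      rcases hx' with h | h <;> simp [h]
    have ey : Even ((y : ℤ) * (p + 1)) := by
      have : Even (((y * (p + 1) : ℕ)) : ℤ) := by
        rw [Int.even_coe_nat]; rcases hy' with h | h
        · exact h.mul_right _
        · exact h.mul_left _
      exact_mod_cast this
    obtain ⟨U, hU⟩ := ex
    obtain ⟨V, hV⟩ := ey
    refine mixes_congr (add_mem_mixes (unif_mem_mixes (T := U) hx hx' (a := 0) (d := 1) ?_)
      (unif_mem_mixes (T := V) hy hy' (a := 0) (d := 1) ?_)) rfl rfl ?_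
    · linarith
    · push_cast; linarith
    · linarith
  rcases Nat.even_or_odd p with hp | hp
  · have hy : Even y := by
      have : Even ((p : ℤ) * x + (p + 1) * y) := ⟨T, by linarith⟩
      have hp' : Even (p : ℤ) := by exact_mod_cast hp
      have h2 : Even (((p : ℤ) + 1) * y) := by
        have := this.sub (hp'.mul_right x); simpa using this
      rw [Int.even_mul] at h2
      rcases h2 with h2 | h2
      · exact absurd h2 (by simpa [Int.even_add_one] using hp')
      · exact_mod_cast h2
    have hy1 : y ≠ 1 := by rintro rfl; exact absurd hy (by decide)
    by_cases hx : x = 1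
    · subst hx
      obtain ⟨y, rfl⟩ : ∃ y', y = y' + 2 := ⟨y - 2, by obtain ⟨z, hz⟩ := hy; omega⟩
      obtain ⟨k, rfl⟩ : ∃ k, p = 2 * k := by obtain ⟨z, hz⟩ := hp; exact ⟨z, by omega⟩
      have hy' : Even y := by simpa [Nat.even_add] using hy
      have hy1' : y ≠ 1 := by rintro rfl; exact absurd hy' (by decide)
      have h2 := split (x := 0) (y := y) (T := T - (3 * k + 1)) (by decide) hy1' (by simp)
        (Or.inl hy') (by push_cast at hT ⊢; linarith)
      refine mixes_congr (add_mem_mixes (unif_long_long_short_mem_mixes k) h2) ?_ (by ring) (by ring)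
      push_cast; module
    · exact split hx hy1 (Or.inr hp) (Or.inl hy) hT
  · have hx : Even x := by
      have : Even ((p : ℤ) * x + (p + 1) * y) := ⟨T, by linarith⟩
      have hp' : Odd (p : ℤ) := by exact_mod_cast hp
      have h2 : Even ((p : ℤ) * x) := by
        have := this.sub ((hp'.add_odd odd_one).mul_right y); simpa using this
      rw [Int.even_mul] at h2
      rcases h2 with h2 | h2
      · exact absurd h2 (Int.not_even_iff_odd.2 hp')
      · exact_mod_cast h2
    have hx1 : x ≠ 1 := by rintro rfl; exact absurd hx (by decide)
    have hp1 : Even (p + 1) := hp.add_odd odd_one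
    by_cases hy : y = 1
    · subst hy
      obtain ⟨x, rfl⟩ : ∃ x', x = x' + 2 := ⟨x - 2, by obtain ⟨z, hz⟩ := hx; omega⟩
      obtain ⟨k, rfl⟩ := hp
      have hx' : Even x := by simpa [Nat.even_add] using hx
      have hx1' : x ≠ 1 := by rintro rfl; exact absurd hx' (by decide)
      have h2 := split (x := x) (y := 0) (T := T - (3 * k + 2)) hx1' (by decide) (Or.inl hx')
        (by simp) (by push_cast at hT ⊢; linarith)
      refine mixes_congr (add_mem_mixes (unif_short_short_long_mem_mixes k) h2) ?_ (by ring) (by ring)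
      push_cast; module
    · exact split hx1 hy (Or.inl hx) (Or.inr hp1) hT

/-! ### Mixing even and odd progressions -/

/-- The average of two extremes: two even entries with one odd entry at least `3`, and three odd
entries with an excess at `1`. The excess makes up for the missing `1` in the first. -/
theorem even_odd_odd_mem_mixes (k : ℕ) :
    unif 0 2 (2 * k + 2) + (2 : ℚ) • unif 1 2 (2 * k + 2) ∈ mixes 3 (6 * k + 5) := by
  have h1 := triple_mem_mixes 0 (0 + 2 * (k + 1)) 2 (k + k) 3 k k rfl
  rw [unif_halves] at h1
  have h2 := mapDomain_mem_mixes 2 1 (flat_mem_mixes (n := 3) (M := 2 * k + 1) (T := 3 * k + 1)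
    (by omega) (by omega) (by omega))
  rw [Finsupp.mapDomain_add, Finsupp.mapDomain_smul, Finsupp.mapDomain_smul, mapDomain_prog,
    Finsupp.mapDomain_single, show (2 : ℤ) * 0 + 1 = 1 by norm_num,
    show (2 : ℤ) * 1 + 1 = 3 by norm_num, show (2 : ℤ) * 1 = 2 by norm_num] at h2
  have h := combo_mem_mixes (mixes_congr h1 rfl rfl (U := 6 * k + 5) (by ring))
    (mixes_congr h2 rfl rfl (by push_cast; ring)) (θ := 1 / 2) (by norm_num) (by norm_num)
  refine mixes_congr h ?_ rfl rfl
  rw [unif.eq_def 3, unif.eq_def 1, show 2 * k + 2 = 2 * k + 1 + 1 by ring, prog_succ 1,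
    show k + k + 1 = 2 * k + 1 by ring, show (1 : ℤ) + 2 = 3 by norm_num]
  push_cast
  match_scalars <;> field_simp <;> ring

theorem even_odd_mem_mixes_of_odd {x y k : ℕ} (hx : Odd x) (hy : Even y) (hy0 : 0 < y) :
    (x : ℚ) • unif 0 2 (2 * k + 2) + (y : ℚ) • unif 1 2 (2 * k + 2) ∈
      mixes (x + y) ((2 * k + 1) * x + (2 * k + 2) * y) := by
  obtain ⟨i, rfl⟩ := hx
  obtain ⟨j, rfl⟩ : ∃ j, y = 2 * j + 2 := by obtain ⟨z, hz⟩ := hy; exact ⟨z - 1, by omega⟩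
  have := add_mem_mixes (add_mem_mixes (even_odd_odd_mem_mixes k)
    (unif_even_mem_mixes 0 2 (2 * k + 1) i)) (unif_even_mem_mixes 1 2 (2 * k + 1) j)
  refine mixes_congr this ?_ (by ring) (by push_cast; ring)
  push_cast; module

/-- If `x + y` or `m` is even, `x + y` copies of the even progression have a constant sum, and
raising `y` random entries by one turns those entries odd. Otherwise `x` and `y` have different
parities, and one block of three from `even_odd_odd_mem_mixes` corrects the parity. -/
theorem even_odd_mem_mixes {x y m : ℕ} (hx : 0 < x) (hy : 0 < y) :
    (x : ℚ) • unif 0 2 (m + 1) + (y : ℚ) • unif 1 2 (m + 1) ∈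
      mixes (x + y) (m * x + (m + 1) * y) := by
  by_cases h : Even (x + y) ∨ Even m
  · have h1 := unif_mem_mixes (n := x + y) (p := m) (a := 0) (d := 2) (T := (x + y : ℕ) * m)
      (by omega) h (by ring)
    have h2 := shift_mem_mixes h1 (Nat.le_add_left y x)
    rw [Finsupp.mapDomain_smul] at h2
    have h3 := mapDomain_unif 1 1 0 2 (m + 1)
    simp only [one_mul, zero_add] at h3
    rw [h3] at h2
    refine mixes_congr h2 ?_ rfl (by push_cast; ring)
    have : ((x + y : ℕ) : ℚ) ≠ 0 := by positivity
    push_cast at this ⊢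
    match_scalars <;> field_simp <;> ring
  · push Not at h
    obtain ⟨k, rfl⟩ := Nat.not_even_iff_odd.1 h.2
    rcases Nat.even_or_odd y with hy' | hy'
    · have hx' : Odd x := by
        rw [Nat.even_add] at h
        rw [← Nat.not_even_iff_odd]; tauto
      refine mixes_congr (even_odd_mem_mixes_of_odd (k := k) hx' hy' hy) rfl rfl (by push_cast; ring)
    · have hx' : Even x := by
        rw [Nat.even_add, ← Nat.not_odd_iff_even (n := y)] at h
        tauto
      -- The reflection `v ↦ 2m + 1 - v` with `m = 2k + 1` exchanges the even and the odd
      -- progression, hence the roles of `x` and `y`.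
      have := mapDomain_mem_mixes (-1) (4 * k + 3) (even_odd_mem_mixes_of_odd (k := k) hy' hx' hx)
      rw [Finsupp.mapDomain_add, Finsupp.mapDomain_smul, Finsupp.mapDomain_smul, mapDomain_unif,
        mapDomain_unif] at this
      have r : ∀ a : ℤ, unif (-1 * a + (4 * k + 3)) (-1 * 2) (2 * k + 2) =
          unif (1 - a) 2 (2 * k + 2) := by
        intro a
        rw [unif, unif, ← prog_neg (1 - a) 2 (2 * k + 1)]
        congr 2; push_cast; ring
      rw [r, r] at this
      refine mixes_congr this ?_ (by ring) (by push_cast; ring)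
      norm_num; abel

/-! ### From averages of empirical measures to couplings -/

/-- The measures realized by uniform draws from lists form a set that is convex over `ℚ`, because
rational weights can be produced by repeating entries. -/
theorem exists_list_of_mem_mixes {n : ℕ} {T : ℤ} {c : ℤ →₀ ℚ} (hc : c ∈ mixes n T) :
    ∃ L : List (Multiset ℤ), L ≠ [] ∧ (∀ s ∈ L, s.card = n ∧ s.sum = T) ∧
      (L.map emp).sum = (L.length : ℚ) • c := by
  let C : Set (ℤ →₀ ℚ) := {c | ∃ L : List (Multiset ℤ), L ≠ [] ∧
    (∀ s ∈ L, s.card = n ∧ s.sum = T) ∧ (L.map emp).sum = (L.length : ℚ) • c}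
  suffices h : mixes n T ⊆ C from h hc
  refine convexHull_min ?_ ?_
  · rintro _ ⟨s, hs, hs', rfl⟩
    exact ⟨[s], by simp, by simp [hs, hs'], by simp⟩
  · rintro c ⟨L, hL, hL', hLc⟩ d ⟨K, hK, hK', hKd⟩ a b ha hb hab
    have hlen : 0 < L.length := List.length_pos_iff.2 hL
    have klen : 0 < K.length := List.length_pos_iff.2 hK
    have sum_rep : ∀ (j : ℕ) (M : List (Multiset ℤ)),
        ((List.replicate j M).flatten.map emp).sum = (j : ℚ) • (M.map emp).sum ∧
        (List.replicate j M).flatten.length = j * M.length ∧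
        ∀ s ∈ (List.replicate j M).flatten, s ∈ M := by
      intro j M
      induction j with
      | zero => simp
      | succ j ih =>
        obtain ⟨i1, i2, i3⟩ := ih
        rw [List.replicate_succ, List.flatten_cons, List.map_append, List.sum_append, i1,
          List.length_append, i2]
        refine ⟨by push_cast; module, by ring, fun s hs => ?_⟩
        rcases List.mem_append.1 hs with hs | hs
        exacts [hs, i3 s hs]
    have ea : a = (a.num.toNat : ℚ) / a.den := by
      have : (a.num.toNat : ℚ) = a.num := by
        exact_mod_cast Int.toNat_of_nonneg (Rat.num_nonneg.2 ha)
      rw [this, Rat.num_div_den]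
    have eb : b = (b.num.toNat : ℚ) / b.den := by
      have : (b.num.toNat : ℚ) = b.num := by
        exact_mod_cast Int.toNat_of_nonneg (Rat.num_nonneg.2 hb)
      rw [this, Rat.num_div_den]
    have da : (a.den : ℚ) ≠ 0 := by exact_mod_cast a.den_nz
    have db : (b.den : ℚ) ≠ 0 := by exact_mod_cast b.den_nz
    generalize a.num.toNat = p at ea
    generalize b.num.toNat = q at eb
    generalize a.den = u at ea da
    generalize b.den = v at eb db
    obtain ⟨x1, x2, x3⟩ := sum_rep (p * v * K.length) L
    obtain ⟨y1, y2, y3⟩ := sum_rep (q * u * L.length) K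
    have hpq : (p : ℚ) * v + q * u = u * v := by
      rw [ea, eb] at hab; field_simp at hab; linarith
    -- The factors `K.length` and `L.length` offset the different lengths, so that the two parts
    -- have sizes in the ratio of `p / u` to `q / v`.
    refine ⟨(List.replicate (p * v * K.length) L).flatten ++
      (List.replicate (q * u * L.length) K).flatten, ?_, ?_, ?_⟩
    · rw [ne_eq, ← List.length_eq_zero_iff, List.length_append, x2, y2]
      have h : ((p * v + q * u : ℕ) : ℚ) ≠ 0 := by
        push_cast; rw [hpq]; positivity
      have h' : p * v + q * u ≠ 0 := by exact_mod_cast h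
      have : p * v * K.length * L.length + q * u * L.length * K.length =
        (p * v + q * u) * (K.length * L.length) := by ring
      rw [this]
      positivity
    · intro s hs
      rcases List.mem_append.1 hs with hs | hs
      exacts [hL' s (x3 s hs), hK' s (y3 s hs)]
    · rw [List.map_append, List.sum_append, x1, y1, List.length_append, x2, y2, hLc, hKd, ea, eb]
      have hA : ((p * v * K.length * L.length + q * u * L.length * K.length : ℕ) : ℚ) =
        u * v * (K.length * L.length) := by
        push_cast; rw [← hpq]; ring
      rw [hA]
      push_cast
      match_scalars <;> field_simp

theorem emp_apply (s : Multiset ℤ) (k : ℤ) : emp s k = s.count k := by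
  induction s using Multiset.induction with
  | empty => simp [emp_zero]
  | cons x s ih =>
    rw [emp_cons, Finsupp.add_apply, ih, Multiset.count_cons, Finsupp.single_apply]
    by_cases h : x = k
    · simp [h, add_comm]
    · simp [h, Ne.symm h]

theorem sum_map_emp_apply (L : List (Multiset ℤ)) (k : ℤ) :
    (L.map emp).sum k = ((L.map fun s => s.count k).sum : ℕ) := by
  induction L with
  | nil => simp
  | cons s L ih => simp [ih, emp_apply]

/-- A nonnegative measure in `mixes` is realized by a list of lists of natural numbers. -/
theorem exists_nat_list_of_mem_mixes {n T : ℕ} {c : ℤ →₀ ℚ} (hc : c ∈ mixes n T)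
    (hneg : ∀ k < 0, c k = 0) :
    ∃ L : List (List ℕ), L ≠ [] ∧ (∀ l ∈ L, l.length = n ∧ l.sum = T) ∧
      ∀ k : ℕ, (((L.map (List.count k)).sum : ℕ) : ℚ) = L.length * c k := by
  obtain ⟨L, hL, hL', h⟩ := exists_list_of_mem_mixes hc
  have hcount : ∀ k, (((L.map fun s => s.count k).sum : ℕ) : ℚ) = L.length * c k := by
    intro k
    have := DFunLike.congr_fun h k
    rw [sum_map_emp_apply] at this
    rw [this]; simp
  -- Counts cannot cancel: a negative entry in any one multiset would give `c` positive mass there.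
  have hnn : ∀ s ∈ L, ∀ x ∈ s, 0 ≤ x := by
    intro s hs x hx
    by_contra hx0
    have h0 := hcount x
    rw [hneg x (not_le.1 hx0), mul_zero] at h0
    have h1 : (L.map fun s => s.count x).sum = 0 := by exact_mod_cast h0
    rw [List.sum_eq_zero_iff] at h1
    have := h1 _ (List.mem_map.2 ⟨s, hs, rfl⟩)
    rw [Multiset.count_eq_zero] at this
    exact this hx
  refine ⟨L.map fun s => (s.map Int.toNat).toList, by simpa using hL, ?_, ?_⟩
  · intro l hl
    obtain ⟨s, hs, rfl⟩ := List.mem_map.1 hl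
    refine ⟨by simpa using (hL' s hs).1, ?_⟩
    rw [Multiset.sum_toList]
    have : ((s.map Int.toNat).sum : ℤ) = T := by
      rw [← (hL' s hs).2, Nat.cast_multiset_sum, Multiset.map_map]
      congr 1
      conv_rhs => rw [← Multiset.map_id s]
      exact Multiset.map_congr rfl fun x hx => Int.toNat_of_nonneg (hnn s hs x hx)
    exact_mod_cast this
  · intro k
    rw [List.length_map, ← hcount k, List.map_map]
    congr 2
    refine List.map_congr_left fun s hs => ?_
    rw [Function.comp_apply, ← Multiset.coe_count, Multiset.coe_toList]
    have : ∀ t : Multiset ℤ, (∀ x ∈ t, 0 ≤ x) → (t.map Int.toNat).count k = t.count (k : ℤ) := by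
      intro t ht
      induction t using Multiset.induction with
      | empty => simp
      | cons x t ih =>
        rw [Multiset.map_cons, Multiset.count_cons, Multiset.count_cons,
          ih fun y hy => ht y (Multiset.mem_cons_of_mem hy)]
        have := ht x (Multiset.mem_cons_self x t)
        congr 1
        by_cases hx : (k : ℤ) = x
        · rw [if_pos hx, if_pos (by omega)]
        · rw [if_neg hx, if_neg (by omega)]
    exact this s (hnn s hs)

/-- All rotations of the entries of a list of lists of length `n`. -/
def rotations (n : ℕ) (L : List (List ℕ)) : List (List ℕ) :=
  L.flatMap fun l => (List.range n).map l.rotate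

theorem length_rotations (n : ℕ) (L : List (List ℕ)) : (rotations n L).length = L.length * n := by
  simp [rotations, List.length_flatMap]

/-- Over all rotations of `l`, a fixed position shows each entry of `l` once; rotating thus gives
all coordinates the same law. -/
theorem countP_rotate (l : List ℕ) (i k : ℕ) (hi : i < l.length) :
    (List.range l.length).countP (fun j => (l.rotate j).getD i 0 = k) = l.count k := by
  have h : ((List.range l.length).map fun j => (l.rotate j).getD i 0) = l.rotate i := by
    refine List.ext_getElem (by simp) fun j hj hj' => ?_
    simp only [List.length_map, List.length_range] at hj
    rw [List.getElem_map, List.getElem_range, List.getD_eq_getElem _ _ (by simpa using hi),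
      List.getElem_rotate, List.getElem_rotate]
    congr 2
    exact Nat.add_comm _ _
  rw [← (List.rotate_perm l i).count_eq k, ← h, List.count_eq_countP, List.countP_map]
  refine List.countP_congr fun j _ => ?_
  simp

theorem countP_rotations {n : ℕ} {L : List (List ℕ)} (hL : ∀ l ∈ L, l.length = n) (i k : ℕ)
    (hi : i < n) :
    (rotations n L).countP (fun l => l.getD i 0 = k) = (L.map (List.count k)).sum := by
  rw [rotations, List.countP_flatMap]
  congr 1
  refine List.map_congr_left fun l hl => ?_
  have := hL l hl
  subst this
  rw [Function.comp_apply, List.countP_map, ← countP_rotate l i k hi]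
  rfl

theorem map_ofMultiset_apply {α β : Type*} [DecidableEq β] (s : Multiset α) (hs : s ≠ 0) (f : α → β)
    (b : β) : (PMF.ofMultiset s hs).map f b = (s.map f).count b / s.card := by
  classical
  rw [PMF.map_apply]
  simp only [PMF.ofMultiset_apply]
  refine (tsum_congr (g := fun a => ((if b = f a then s.count a else 0 : ℕ) : ℝ≥0∞) *
    (s.card : ℝ≥0∞)⁻¹) fun a => ?_).trans ?_
  · split_ifs <;> simp [div_eq_mul_inv]
  rw [ENNReal.tsum_mul_right, ← div_eq_mul_inv]
  congr 1
  rw [tsum_eq_sum (s := s.toFinset) fun a ha => by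
    have : s.count a = 0 := by simpa using ha
    simp [this]]
  rw [← Nat.cast_sum, Multiset.count_map]
  congr 1
  rw [← Multiset.sum_count_eq_card (s := s.toFinset) (m := s.filter fun a => b = f a)
    (by intro a ha; simpa using (Multiset.mem_filter.1 ha).1)]
  refine sum_congr rfl fun a _ => ?_
  rw [Multiset.count_filter]

theorem hasMarginals_ofList {n : ℕ} {L : List (List ℕ)} (hL : L ≠ []) {μ : ℕ → ℝ} :
    HasMarginals (ofList n L hL) μ ↔
      ∀ i < n, ∀ k, (L.countP (fun l => l.getD i 0 = k) : ℝ) / L.length = μ k := by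
  have key : ∀ (i : Fin n) (k : ℕ), ((ofList n L hL).map (fun x => x i) k).toReal =
      (L.countP (fun l => l.getD i 0 = k) : ℝ) / L.length := by
    intro i k
    rw [ofList, map_ofMultiset_apply, Multiset.map_coe, Multiset.coe_count, Multiset.coe_card,
      List.map_map, List.length_map, List.count_eq_countP, List.countP_map, ENNReal.toReal_div]
    simp only [ENNReal.toReal_natCast]
    congr 2
  constructor
  · intro h i hi k
    rw [← key ⟨i, hi⟩ k]; exact h _ _
  · intro h i k
    rw [key]; exact h i i.2 k

theorem support_ofList {n : ℕ} {L : List (List ℕ)} (hL : L ≠ []) (x : Fin n → ℕ) :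
    x ∈ (ofList n L hL).support ↔ ∃ l ∈ L, (fun i : Fin n => l.getD i 0) = x := by
  classical
  rw [ofList, PMF.mem_support_ofMultiset_iff]
  simp

theorem sum_getD {n : ℕ} {l : List ℕ} (hl : l.length = n) : ∑ i : Fin n, l.getD i 0 = l.sum := by
  subst hl
  rw [← Fin.sum_univ_getElem]
  exact sum_congr rfl fun i _ => List.getD_eq_getElem _ _ i.2

theorem listIsJointMix_iff {n T : ℕ} {μ : ℕ → ℝ} {L : List (List ℕ)} :
    ListIsJointMix n T μ L ↔ L ≠ [] ∧ (∀ l ∈ L, l.length = n ∧ l.sum = T) ∧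
      ∀ i < n, ∀ k, (L.countP (fun l => l.getD i 0 = k) : ℝ) / L.length = μ k := by
  constructor
  · rintro ⟨hn, hL, hm, hs⟩
    refine ⟨hL, fun l hl => ⟨hn l hl, ?_⟩, (hasMarginals_ofList hL).1 hm⟩
    rw [← sum_getD (hn l hl)]
    exact hs _ ((support_ofList hL _).2 ⟨l, hl, rfl⟩)
  · rintro ⟨hL, h, hm⟩
    refine ⟨fun l hl => (h l hl).1, hL, (hasMarginals_ofList hL).2 hm, fun x hx => ?_⟩
    obtain ⟨l, hl, rfl⟩ := (support_ofList hL _).1 hx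
    rw [sum_getD (h l hl).1, (h l hl).2]

/-- `n μ` is an average of counting measures of multisets with `n` elements and sum `T`. -/
def RatMix (n T : ℕ) (μ : ℕ → ℝ) : Prop :=
  ∃ c ∈ mixes n T, ∀ k : ℤ, (c k : ℝ) = if 0 ≤ k then n * μ k.toNat else 0

theorem RatMix.exists_list {n T : ℕ} {μ : ℕ → ℝ} (hn : n ≠ 0) (h : RatMix n T μ) :
    ∃ L, ListIsJointMix n T μ L := by
  obtain ⟨c, hc, hk⟩ := h
  obtain ⟨L, hL, hL', hcount⟩ := exists_nat_list_of_mem_mixes hc fun k hk0 => by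
    have := hk k
    rw [if_neg (not_le.2 hk0)] at this
    exact_mod_cast this
  have hlen : L.length ≠ 0 := by simpa using hL
  refine ⟨rotations n L, listIsJointMix_iff.2 ⟨?_, ?_, fun i hi k => ?_⟩⟩
  · rw [ne_eq, ← List.length_eq_zero_iff, length_rotations]
    exact Nat.mul_ne_zero hlen hn
  · intro l hl
    obtain ⟨l', hl', hl⟩ := List.mem_flatMap.1 hl
    obtain ⟨j, -, rfl⟩ := List.mem_map.1 hl
    rw [List.length_rotate, (List.rotate_perm l' j).sum_eq]
    exact hL' l' hl'
  · rw [countP_rotations (fun l hl => (hL' l hl).1) i k hi, length_rotations]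
    have h1 := hcount k
    have h2 := hk k
    simp only [Int.natCast_nonneg, if_true, Int.toNat_natCast] at h2
    generalize (L.map (List.count k)).sum = S at h1 ⊢
    have h3 : (S : ℝ) = L.length * (c k : ℝ) := by exact_mod_cast h1
    rw [h3, h2]
    push_cast
    have : (L.length : ℝ) ≠ 0 := by exact_mod_cast hlen
    have : (n : ℝ) ≠ 0 := by exact_mod_cast hn
    field_simp

theorem RatMix.combo {n T : ℕ} {μ ν : ℕ → ℝ} (h : RatMix n T μ) (h' : RatMix n T ν) {θ : ℚ}
    (h0 : 0 ≤ θ) (h1 : θ ≤ 1) : RatMix n T (mix θ μ ν) := by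
  obtain ⟨c, hc, hk⟩ := h
  obtain ⟨d, hd, hk'⟩ := h'
  refine ⟨_, combo_mem_mixes hc hd h0 h1, fun k => ?_⟩
  have e1 := hk k
  have e2 := hk' k
  rw [Finsupp.add_apply, Finsupp.smul_apply, Finsupp.smul_apply, smul_eq_mul, smul_eq_mul]
  push_cast
  rw [e1, e2]
  split_ifs
  · simp only [mix]; ring
  · ring

/-! ### The optimal marginals are averages of empirical measures -/

/-- The measure `c` on the integers is given by the function `μ` on the natural numbers. -/
def Represents (c : ℤ →₀ ℚ) (μ : ℕ → ℝ) : Prop :=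
  ∀ k : ℤ, (c k : ℝ) = if 0 ≤ k then μ k.toNat else 0

theorem Represents.add {c d : ℤ →₀ ℚ} {μ ν : ℕ → ℝ} (h : Represents c μ) (h' : Represents d ν) :
    Represents (c + d) (fun k => μ k + ν k) := by
  intro k
  rw [Finsupp.add_apply, Rat.cast_add, h, h']
  split_ifs <;> simp

theorem Represents.smul {c : ℤ →₀ ℚ} {μ : ℕ → ℝ} (h : Represents c μ) (a : ℚ) :
    Represents (a • c) (fun k => a * μ k) := by
  intro k
  rw [Finsupp.smul_apply, smul_eq_mul, Rat.cast_mul, h]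
  split_ifs <;> simp

theorem RatMix.of_represents {n T : ℕ} {U : ℤ} {c : ℤ →₀ ℚ} {μ ν : ℕ → ℝ} (hc : c ∈ mixes n U)
    (hU : U = T) (h : Represents c ν) (hν : ∀ k, ν k = n * μ k) : RatMix n T μ := by
  subst hU
  refine ⟨c, hc, fun k => ?_⟩
  rw [h k, hν]

theorem represents_dirac0 : Represents (Finsupp.single 0 1) dirac0 := by
  intro k
  rw [Finsupp.single_apply, dirac0]
  rcases lt_trichotomy k 0 with h | rfl | h
  · rw [if_neg h.ne', if_neg (not_le.2 h)]; simp
  · simp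
  · rw [if_neg h.ne, if_pos h.le, if_neg (by omega)]; simp

theorem prog_two_apply (a k : ℤ) (N : ℕ) :
    prog a 2 N k = if a ≤ k ∧ k < a + 2 * N ∧ (k - a) % 2 = 0 then 1 else 0 := by
  induction N with
  | zero =>
    rw [if_neg (by push_cast; omega)]; simp [prog]
  | succ N ih =>
    rw [prog_succ', Finsupp.add_apply, ih, Finsupp.single_apply]
    push_cast
    by_cases h : a + 2 * (N : ℤ) = k
    · rw [if_neg (by omega), if_pos h, if_pos (by omega), zero_add]
    · rw [if_neg h, add_zero]
      congr 1
      rw [eq_iff_iff]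
      omega

theorem represents_unifEven (m : ℕ) : Represents (unif 0 2 (m + 1)) (unifEven m) := by
  intro k
  rw [unif, Finsupp.smul_apply, prog_two_apply, unifEven]
  by_cases h0 : 0 ≤ k
  · lift k to ℕ using h0
    rw [if_pos (Int.natCast_nonneg k), Int.toNat_natCast]
    by_cases h : Even k ∧ k ≤ 2 * m
    · have := Nat.even_iff.1 h.1
      rw [if_pos h, if_pos (by push_cast; omega)]; simp
    · rw [if_neg h, if_neg (by rw [Nat.even_iff] at h; push_cast; omega)]; simp
  · rw [if_neg h0, if_neg (by omega)]; simp

theorem represents_unifOdd (m : ℕ) : Represents (unif 1 2 m) (unifOdd m) := by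
  intro k
  rw [unif, Finsupp.smul_apply, prog_two_apply, unifOdd]
  by_cases h0 : 0 ≤ k
  · lift k to ℕ using h0
    rw [if_pos (Int.natCast_nonneg k), Int.toNat_natCast]
    by_cases h : Odd k ∧ k < 2 * m
    · have := Nat.odd_iff.1 h.1
      rw [if_pos h, if_pos (by omega)]; simp
    · rw [if_neg h, if_neg (by rw [Nat.odd_iff] at h; omega)]; simp
  · rw [if_neg h0, if_neg (by omega)]; simp

theorem ratMix_unifEven {n m : ℕ} (hn : 2 ≤ n) (h : Even n ∨ Even m) :
    RatMix n (m * n) (unifEven m) := by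
  refine .of_represents (unif_mem_mixes (a := 0) (d := 2) (T := m * n) (by omega) h (by ring))
    (by push_cast; ring) ((represents_unifEven m).smul n) fun k => by simp

theorem ratMix_unifOdd {n m : ℕ} (hn : 2 ≤ n) (hm : 0 < m) (h : Even n ∨ Odd m) :
    RatMix n (m * n) (unifOdd m) := by
  obtain ⟨p, rfl⟩ := Nat.exists_eq_add_of_le' hm
  refine .of_represents (unif_mem_mixes (p := p) (a := 1) (d := 2) (T := (p + 1) * n) (by omega) ?_
    (by ring)) (by push_cast; ring) ((represents_unifOdd (p + 1)).smul n) fun k => by simp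
  rwa [Nat.odd_add_one, Nat.not_odd_iff_even] at h

theorem ratMix_even_odd {n m r : ℕ} (h0 : 0 < r) (hr : r < n) :
    RatMix n (m * n + r) (mix ((r : ℝ) / n) (unifEven m) (unifOdd (m + 1))) := by
  obtain ⟨x, rfl⟩ : ∃ x, n = x + r := ⟨n - r, by omega⟩
  refine .of_represents (even_odd_mem_mixes (x := x) (y := r) (m := m) (by omega) h0)
    (by push_cast; ring)
    (((represents_unifEven m).smul x).add ((represents_unifOdd (m + 1)).smul r)) fun k => ?_
  have : ((x + r : ℕ) : ℝ) ≠ 0 := by positivity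
  simp only [mix]
  push_cast at this ⊢
  field_simp
  ring

/-- The map `v ↦ 2v + 1` carries the intervals of `unif_consecutive_mem_mixes` to the two odd
progressions. A sum of `n` odd numbers has the parity of `n`, hence the condition on the total. -/
theorem ratMix_odd_odd {n m r : ℕ} (hn : 2 ≤ n) (hm : 0 < m) (hr : r < n)
    (h : Even (m * n + r) ↔ Even n) :
    RatMix n (m * n + r) (mix ((r : ℝ) / n) (unifOdd m) (unifOdd (m + 1))) := by
  obtain ⟨x, rfl⟩ : ∃ x, n = x + r := ⟨n - r, by omega⟩
  obtain ⟨p, rfl⟩ := Nat.exists_eq_add_of_le' hm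
  obtain ⟨U, hU⟩ : ∃ U, p * x + (p + 1) * r = 2 * U := by
    have : Even ((p * x + (p + 1) * r) + (x + r) ) ↔ Even (x + r) := by
      rw [← h]; ring_nf
    rw [Nat.even_add] at this
    have : Even (p * x + (p + 1) * r) := by tauto
    obtain ⟨U, hU⟩ := this
    exact ⟨U, by omega⟩
  have hU' : ((p : ℤ) * x + (p + 1) * r) = 2 * U := by exact_mod_cast hU
  have h1 := mapDomain_mem_mixes 2 1 (unif_consecutive_mem_mixes (x := x) (y := r) (p := p) hn hU'.symm)
  rw [Finsupp.mapDomain_add, Finsupp.mapDomain_smul, Finsupp.mapDomain_smul, mapDomain_unif,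
    mapDomain_unif] at h1
  refine .of_represents h1 ?_
    (((represents_unifOdd (p + 1)).smul x).add ((represents_unifOdd (p + 2)).smul r)) fun k => ?_
  · push_cast; rw [← hU']; ring
  have : ((x + r : ℕ) : ℝ) ≠ 0 := by positivity
  simp only [mix]
  push_cast at this ⊢
  field_simp
  ring

/-- Twice a flat partition of `T / 2` with parts of size at most `m`. -/
theorem ratMix_dirac0_even {n m T : ℕ} (hn : 2 ≤ n) (hm : 0 < m) (hT : Even T) (h1 : 2 * m ≤ T)
    (h2 : T ≤ m * n) : RatMix n T (mix ((T : ℝ) / n / m) dirac0 (unifEven m)) := by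
  obtain ⟨U, rfl⟩ := hT
  have h := mapDomain_mem_mixes 2 0 (flat_mem_mixes (n := n) (M := m) (T := U) hm (by omega)
    (by linarith))
  rw [Finsupp.mapDomain_add, Finsupp.mapDomain_smul, Finsupp.mapDomain_smul, mapDomain_prog,
    Finsupp.mapDomain_single] at h
  have hm0 : (m : ℚ) ≠ 0 := by positivity
  have e : ((n : ℚ) - 2 * U / m) • Finsupp.single 0 1 + ((2 * U : ℚ) / m) • unif 0 2 (m + 1) ∈
      mixes n (2 * U + n * 0) := by
    refine mixes_congr h ?_ rfl rfl
    rw [show (2 : ℤ) * 0 + 0 = 0 by norm_num, show (2 : ℤ) * 1 + 0 = 2 by norm_num,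
      show (2 : ℤ) * 1 = 2 by norm_num, unif, prog_succ, zero_add]
    push_cast
    match_scalars <;> field_simp <;> ring
  refine .of_represents e (by push_cast; ring)
    ((represents_dirac0.smul _).add ((represents_unifEven m).smul _)) fun k => ?_
  have hm0 : (m : ℝ) ≠ 0 := by positivity
  have hn0 : (n : ℝ) ≠ 0 := by positivity
  simp only [mix]
  push_cast
  field_simp
  ring

theorem prog_interleave (a : ℤ) (N : ℕ) : prog a 1 (2 * N) = prog a 2 N + prog (a + 1) 2 N := by
  induction N with
  | zero => simp [prog]
  | succ N ih =>
    rw [show 2 * (N + 1) = 2 * N + 1 + 1 by ring, prog_succ', prog_succ', prog_succ', prog_succ', ih]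
    push_cast
    rw [show a + 1 * (2 * N) = a + 2 * (N : ℤ) by ring,
      show a + 1 * (2 * N + 1) = a + 1 + 2 * (N : ℤ) by ring]
    abel

/-- A flat partition of `T` with parts of size at most `2m`. The uniform law on `0, …, 2m` has `m`
odd points out of `2m + 1`, which is the source of the weight `m / (2m + 1)`. -/
theorem ratMix_dirac0_even_odd {n m T : ℕ} (hn : 2 ≤ n) (hm : 0 < m) (h1 : 2 * m ≤ T)
    (h2 : T ≤ m * n) : RatMix n T
      (mix ((T : ℝ) / n / m) dirac0 (mix ((m : ℝ) / (2 * m + 1)) (unifEven m) (unifOdd m))) := by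
  have h := flat_mem_mixes (n := n) (M := 2 * m) (T := T) (by omega) h1 (by linarith)
  have hm0 : (m : ℚ) ≠ 0 := by positivity
  have e : ((n : ℚ) - T / m) • Finsupp.single 0 1 +
      (((T / m * ((m + 1) / (2 * m + 1)) : ℚ)) • unif 0 2 (m + 1) +
        (T / m * (m / (2 * m + 1)) : ℚ) • unif 1 2 m) ∈ mixes n T := by
    refine mixes_congr h ?_ rfl rfl
    rw [unif, unif, prog_succ, prog_interleave, zero_add, show (1 : ℤ) + 1 = 2 by norm_num]
    push_cast
    match_scalars <;> field_simp <;> ring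
  refine .of_represents e rfl ((represents_dirac0.smul _).add
    (((represents_unifEven m).smul _).add ((represents_unifOdd m).smul _))) fun k => ?_
  have hm0 : (m : ℝ) ≠ 0 := by positivity
  have hn0 : (n : ℝ) ≠ 0 := by positivity
  simp only [mix]
  push_cast
  field_simp
  ring

/-! ### The table -/

theorem mix_zero (μ ν : ℕ → ℝ) : mix 0 μ ν = μ := by funext k; simp [mix]

theorem mix_one (μ ν : ℕ → ℝ) : mix 1 μ ν = ν := by funext k; simp [mix]

/-- The table is affine in its free weight, so couplings at two extreme weights yield all weights
between them. -/
theorem lottoA_eq_mix (n TA TB : ℕ) (s : ℝ) :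
    lottoA n TA TB s = mix s (lottoA n TA TB 0) (lottoA n TA TB 1) := by
  funext k
  simp only [lottoA, mix]
  split_ifs <;> (try simp only [mix]) <;> ring

theorem lottoB_eq_mix (n TA TB : ℕ) {t u : ℝ} (hu : u ≠ 0) :
    lottoB n TA TB t = mix (t / u) (lottoB n TA TB 0) (lottoB n TA TB u) := by
  funext k
  simp only [lottoB, mix]
  split_ifs <;> (try simp only [mix]) <;> field_simp <;> ring

/-- The hypotheses of the theorem. -/
structure Admissible (n TA TB : ℕ) : Prop where
  two_le : 2 ≤ n
  le : TB ≤ TA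
  even : Even TB
  parity : Even TA ↔ Even n
  large : 2 * (TA / n) ≤ TB

variable {n TA TB : ℕ}

theorem Admissible.even_of_eq (h : Admissible n TA TB) (hT : TB = TA) : Even n :=
  h.parity.1 (hT ▸ h.even)

theorem Admissible.exists_eq (h : Admissible n TA TB) :
    ∃ m r, TA / n = m ∧ TA = m * n + r ∧ r < n := by
  refine ⟨TA / n, TA % n, rfl, ?_, Nat.mod_lt _ (by have := h.two_le; omega)⟩
  rw [mul_comm]; exact (Nat.div_add_mod TA n).symm

theorem excess_div {n : ℕ} (m r : ℕ) (hn : 2 ≤ n) : ((m * n + r : ℕ) : ℝ) / n - m = r / n := by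
  have : (n : ℝ) ≠ 0 := by positivity
  push_cast; field_simp; ring

theorem Admissible.ratMix_lottoA_zero (h : Admissible n TA TB) :
    RatMix n TA (lottoA n TA TB 0) := by
  obtain ⟨m, r, hm, rfl, hr⟩ := h.exists_eq
  have hn := h.two_le
  have hpar := h.parity
  simp only [lottoA, hm, mix_zero, excess_div m r hn]
  split_ifs with h1 h2 h3 h4
  · obtain rfl : r = 0 := by omega
    exact ratMix_unifEven hn (Or.inl (h.even_of_eq h2))
  · obtain rfl : r = 0 := by omega
    have hm0 : 0 < m := by
      rcases Nat.eq_zero_or_pos m with rfl | h0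
      · have := h.le; simp at this h2; omega
      · exact h0
    refine ratMix_unifOdd hn hm0 ?_
    rw [add_zero, Nat.even_mul] at hpar
    rw [← Nat.not_even_iff_odd]
    tauto
  · exact ratMix_even_odd (by omega) hr
  · exact ratMix_even_odd (by omega) hr
  · refine ratMix_odd_odd hn ?_ hr hpar
    by_contra h0
    obtain rfl : m = 0 := by omega
    omega

theorem Admissible.ratMix_lottoA_one (h : Admissible n TA TB) (hm0 : 0 < TA / n) :
    RatMix n TA (lottoA n TA TB 1) := by
  -- Only the rows `a = b = m` and `b = m < a` involve the free weight; elsewhere the weight `0`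
  -- gives the same marginal.
  by_cases h1 : TA = TA / n * n ∧ TB = TA ∨ TA ≠ TA / n * n ∧ TB = TA / n * n
  · obtain ⟨m, r, hm, rfl, hr⟩ := h.exists_eq
    have hn := h.two_le
    rw [hm] at h1 hm0
    simp only [lottoA, hm, mix_one, excess_div m r hn]
    rcases h1 with ⟨h1, h2⟩ | ⟨h1, h2⟩
    · rw [if_pos h1, if_pos h2]
      obtain rfl : r = 0 := by omega
      exact ratMix_unifOdd hn hm0 (Or.inl (h.even_of_eq h2))
    · rw [if_neg h1, if_neg (by omega), if_pos h2]
      exact ratMix_odd_odd hn hm0 hr h.parity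
  · have : lottoA n TA TB 1 = lottoA n TA TB 0 := by
      simp only [lottoA]
      split_ifs <;> tauto
    rw [this]
    exact h.ratMix_lottoA_zero

theorem Admissible.ratMix_lottoB_zero (h : Admissible n TA TB) :
    RatMix n TB (lottoB n TA TB 0) := by
  obtain ⟨m, r, hm, rfl, hr⟩ := h.exists_eq
  have hn := h.two_le
  have hle := h.le
  have hlarge := h.large
  rw [hm] at hlarge
  simp only [lottoB, hm, mix_zero]
  split_ifs with h1 h2 h3 h4
  · obtain rfl : r = 0 := by omega
    rw [h2]
    exact ratMix_unifEven hn (Or.inl (h.even_of_eq h2))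
  · refine ratMix_dirac0_even hn ?_ h.even hlarge (by omega)
    by_contra h0
    obtain rfl : m = 0 := by omega
    omega
  · obtain ⟨q, rfl⟩ := Nat.exists_eq_add_of_le h3.le
    rw [excess_div m q hn]
    exact ratMix_even_odd (by omega) (by omega)
  · rw [h4]
    refine ratMix_unifEven hn ?_
    have := h.even
    rw [h4, Nat.even_mul] at this
    exact this.symm
  · refine ratMix_dirac0_even hn ?_ h.even hlarge (by omega)
    by_contra h0
    obtain rfl : m = 0 := by omega
    omega

/-- The largest weight of the odd part that is allowed for player `B`. -/
def maxWeightB (n TA TB : ℕ) : ℚ :=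
  if TB = TA then 1 else ((TA / n : ℕ) : ℚ) / (2 * ((TA / n : ℕ) : ℚ) + 1)

theorem maxWeightB_pos (hm0 : 0 < TA / n) : 0 < maxWeightB n TA TB := by
  unfold maxWeightB
  split_ifs
  · norm_num
  · positivity

theorem Admissible.ratMix_lottoB_max (h : Admissible n TA TB) (hm0 : 0 < TA / n) :
    RatMix n TB (lottoB n TA TB (maxWeightB n TA TB)) := by
  by_cases h1 : TA = TA / n * n
  · obtain ⟨m, r, hm, rfl, hr⟩ := h.exists_eq
    have hn := h.two_le
    have hle := h.le
    have hlarge := h.large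
    rw [hm] at h1 hm0 hlarge
    simp only [lottoB, hm, if_pos h1, maxWeightB]
    obtain rfl : r = 0 := by omega
    split_ifs with h2
    · rw [h2, Rat.cast_one, mix_one]
      exact ratMix_unifOdd hn hm0 (Or.inl (h.even_of_eq h2))
    · push_cast
      exact ratMix_dirac0_even_odd hn hm0 hlarge hle
  · have : lottoB n TA TB (maxWeightB n TA TB) = lottoB n TA TB 0 := by
      simp only [lottoB, if_neg h1]
    rw [this]
    exact h.ratMix_lottoB_zero

/-! ### Payoffs and saddle points -/

theorem win_ne_top (x y : ℕ) : win x y ≠ ∞ := by unfold win; split_ifs <;> simp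

theorem win_add_win (x y : ℕ) : win x y + win y x = 1 := by
  unfold win
  rcases lt_trichotomy x y with h | rfl | h
  · simp [h, h.not_gt, h.ne]
  · simp [ENNReal.inv_two_add_inv_two]
  · simp [h, h.not_gt, h.ne]

theorem expPayoff_eq (σ τ : Strategy n) :
    expPayoff σ τ = ∑ i, ∑' x, σ x * ∑' y, τ y * win (x i) (y i) := by
  rw [expPayoff, ← Summable.tsum_finsetSum fun _ _ => ENNReal.summable]
  refine tsum_congr fun x => ?_
  rw [← mul_sum, ← Summable.tsum_finsetSum fun _ _ => ENNReal.summable, ← ENNReal.tsum_mul_left]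
  refine tsum_congr fun y => ?_
  rw [payoff, mul_assoc, mul_sum]

theorem expPayoff_add (σ τ : Strategy n) : expPayoff σ τ + expPayoff τ σ = n := by
  rw [expPayoff, expPayoff, ENNReal.tsum_comm (f := fun x y => τ x * σ y * payoff x y),
    ← ENNReal.tsum_add]
  have : ∀ x, (∑' y, σ x * τ y * payoff x y) + ∑' y, τ y * σ x * payoff y x = σ x * n := by
    intro x
    rw [← ENNReal.tsum_add]
    have : ∀ y, σ x * τ y * payoff x y + τ y * σ x * payoff y x = σ x * n * τ y := by
      intro y
      have : payoff x y + payoff y x = n := by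
        rw [payoff, payoff, ← sum_add_distrib]; simp [win_add_win]
      rw [mul_comm (τ y), ← mul_add, this]; ring
    simp_rw [this]
    rw [ENNReal.tsum_mul_left, τ.tsum_coe, mul_one]
  simp_rw [this]
  rw [ENNReal.tsum_mul_right, σ.tsum_coe, one_mul]

/-- The game has constant sum `n`, so a cap on the opponent's payoff is a guarantee for the player.
-/
theorem le_expPayoff {S' : Set (Strategy n)} {σ τ : Strategy n} {v w : ℝ≥0∞} (hw : w ≠ ∞)
    (hB : ∀ τ ∈ S', expPayoff τ σ ≤ w) (hv : v + w ≤ n) (hτ : τ ∈ S') : v ≤ expPayoff σ τ := by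
  refine (ENNReal.add_le_add_iff_right hw).1 (hv.trans ?_)
  rw [← expPayoff_add σ τ]
  gcongr
  exact hB τ hτ

theorem isOptimal_of_saddle {S S' : Set (Strategy n)} {σ τ : Strategy n} {v w : ℝ≥0∞} (hw : w ≠ ∞)
    (hσ : σ ∈ S) (hτ : τ ∈ S') (hA : ∀ σ ∈ S, expPayoff σ τ ≤ v)
    (hB : ∀ τ ∈ S', expPayoff τ σ ≤ w) (hv : v + w ≤ n) : IsOptimal S S' σ :=
  ⟨hσ, fun σ' hσ' => (iInf₂_le τ hτ).trans <| (hA σ' hσ').trans <|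
    le_iInf₂ fun _ hτ' => le_expPayoff hw hB hv hτ'⟩

theorem isNash_of_saddle {S S' : Set (Strategy n)} {σ τ : Strategy n} {v w : ℝ≥0∞} (hv' : v ≠ ∞)
    (hw : w ≠ ∞) (hσ : σ ∈ S) (hτ : τ ∈ S') (hA : ∀ σ ∈ S, expPayoff σ τ ≤ v)
    (hB : ∀ τ ∈ S', expPayoff τ σ ≤ w) (hv : v + w ≤ n) : IsNash S S' σ τ :=
  ⟨hσ, hτ, fun σ' hσ' => (hA σ' hσ').trans (le_expPayoff hw hB hv hτ),
    fun τ' hτ' => (hB τ' hτ').trans (le_expPayoff hv' hA (by rwa [add_comm]) hσ)⟩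

theorem blotto_subset_lotto (n T : ℕ) : blotto n T ⊆ lotto n T := by
  intro σ hσ
  rw [lotto, Set.mem_ofPred_eq, ← Summable.tsum_finsetSum fun _ _ => ENNReal.summable]
  calc ∑' x, ∑ i, σ x * (x i : ℝ≥0∞) ≤ ∑' x, σ x * T := by
        refine ENNReal.tsum_le_tsum fun x => ?_
        rw [← mul_sum]
        by_cases hx : x ∈ σ.support
        · gcongr
          exact_mod_cast hσ x hx
        · rw [PMF.mem_support_iff, not_not] at hx
          simp [hx]
    _ = T := by rw [ENNReal.tsum_mul_right, σ.tsum_coe, one_mul]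

/-! ### Expectations with respect to the marginals -/

/-- The integral of `g` with respect to a measure on `{0, …, 2m + 1}`. -/
def dot (m : ℕ) (μ g : ℕ → ℝ) : ℝ := ∑ k ∈ range (2 * (m + 1)), μ k * g k

theorem dot_mix (m : ℕ) (t : ℝ) (μ ν g : ℕ → ℝ) :
    dot m (mix t μ ν) g = (1 - t) * dot m μ g + t * dot m ν g := by
  simp only [dot, mul_sum, ← sum_add_distrib]
  refine sum_congr rfl fun k _ => ?_
  simp only [mix]; ring

theorem tsum_marginal (τ : Strategy n) (i : Fin n) (g : ℕ → ℝ≥0∞) :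
    ∑' y, τ y * g (y i) = ∑' k, τ.map (fun x => x i) k * g k := by
  simp_rw [PMF.map_apply, ← ENNReal.tsum_mul_right]
  rw [ENNReal.tsum_comm]
  refine tsum_congr fun y => ?_
  rw [tsum_eq_single (y i) fun k hk => by rw [if_neg hk, zero_mul], if_pos rfl]

theorem tsum_marginal_eq_dot {τ : Strategy n} {μ : ℕ → ℝ} (h : HasMarginals τ μ) {m : ℕ}
    (hμ : ∀ k, 2 * (m + 1) ≤ k → μ k = 0) (i : Fin n) {g : ℕ → ℝ≥0∞} (hg : ∀ k, g k ≠ ∞) :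
    ∑' y, τ y * g (y i) = ENNReal.ofReal (dot m μ fun k => (g k).toReal) := by
  have hnn : ∀ k, 0 ≤ μ k := fun k => by rw [← h i k]; exact ENNReal.toReal_nonneg
  have e : ∀ k, τ.map (fun x => x i) k = ENNReal.ofReal (μ k) := fun k => by
    rw [← h i k, ENNReal.ofReal_toReal (PMF.apply_ne_top _ _)]
  rw [tsum_marginal, tsum_eq_sum (s := range (2 * (m + 1))) fun k hk => by
    rw [e, hμ k (by simpa using hk)]; simp, dot,
    ENNReal.ofReal_sum_of_nonneg fun k _ => mul_nonneg (hnn k) ENNReal.toReal_nonneg]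
  refine sum_congr rfl fun k _ => ?_
  rw [e, ENNReal.ofReal_mul (hnn k), ENNReal.ofReal_toReal (hg k)]

/-- Winning probability as a real number. -/
noncomputable def winReal (x y : ℕ) : ℝ := (win x y).toReal

theorem winReal_eq (x y : ℕ) : winReal x y = if y < x then 1 else if x = y then 1 / 2 else 0 := by
  unfold winReal win
  split_ifs <;> simp

/-- An affine bound on the winning probability against `μ` bounds the payoff against couplings
of `μ` in the Lotto game. -/
theorem expPayoff_le_of_affine {T m : ℕ} {σ τ : Strategy n} {μ : ℕ → ℝ} (h : HasMarginals τ μ)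
    (hμ : ∀ k, 2 * (m + 1) ≤ k → μ k = 0) {c d : ℝ} (hc : 0 ≤ c) (hd : 0 ≤ d)
    (hb : ∀ x : ℕ, dot m μ (winReal x) ≤ c + d * x) (hσ : σ ∈ lotto n T) :
    expPayoff σ τ ≤ ENNReal.ofReal (n * c + d * T) := by
  rw [expPayoff_eq]
  calc ∑ i, ∑' x, σ x * ∑' y, τ y * win (x i) (y i)
      ≤ ∑ i, ∑' x, (σ x * ENNReal.ofReal c + ENNReal.ofReal d * (σ x * (x i : ℝ≥0∞))) := by
        gcongr with i _ x
        rw [tsum_marginal_eq_dot h hμ i (g := win (x i)) (win_ne_top _)]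
        calc _ ≤ σ x * ENNReal.ofReal (c + d * x i) := by gcongr; exact hb (x i)
          _ = _ := by
            rw [ENNReal.ofReal_add hc (by positivity), ENNReal.ofReal_mul hd, ENNReal.ofReal_natCast]
            ring
    _ = n * ENNReal.ofReal c + ENNReal.ofReal d * ∑ i, ∑' x, σ x * (x i : ℝ≥0∞) := by
        simp_rw [ENNReal.tsum_add, ENNReal.tsum_mul_left, ENNReal.tsum_mul_right, σ.tsum_coe]
        rw [sum_add_distrib, mul_sum]
        simp
    _ ≤ n * ENNReal.ofReal c + ENNReal.ofReal d * T := by gcongr; exact hσ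
    _ = ENNReal.ofReal (n * c + d * T) := by
        rw [ENNReal.ofReal_add (by positivity) (by positivity), ENNReal.ofReal_mul (by positivity),
          ENNReal.ofReal_mul hd, ENNReal.ofReal_natCast, ENNReal.ofReal_natCast]

theorem mem_lotto_of_dot {T m : ℕ} {τ : Strategy n} {μ : ℕ → ℝ} (hn : n ≠ 0) (h : HasMarginals τ μ)
    (hμ : ∀ k, 2 * (m + 1) ≤ k → μ k = 0) (hmean : dot m μ (fun k => k) = (T : ℝ) / n) :
    τ ∈ lotto n T := by
  rw [lotto, Set.mem_ofPred_eq]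
  have : ∀ i : Fin n, ∑' x, τ x * (x i : ℝ≥0∞) = ENNReal.ofReal ((T : ℝ) / n) := by
    intro i
    rw [tsum_marginal_eq_dot h hμ i (g := fun k => (k : ℝ≥0∞)) fun k => ENNReal.natCast_ne_top k]
    simp only [ENNReal.toReal_natCast]
    rw [hmean]
  simp_rw [this]
  rw [sum_const, card_univ, Fintype.card_fin, nsmul_eq_mul, ← ENNReal.ofReal_natCast n,
    ← ENNReal.ofReal_mul (by positivity)]
  have hn' : (n : ℝ) ≠ 0 := by exact_mod_cast hn
  rw [mul_div_cancel₀ _ hn', ENNReal.ofReal_natCast]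

theorem sum_range_two_mul (f : ℕ → ℝ) (N : ℕ) :
    ∑ k ∈ range (2 * N), f k = ∑ i ∈ range N, f (2 * i) + ∑ i ∈ range N, f (2 * i + 1) := by
  induction N with
  | zero => simp
  | succ N ih =>
    rw [show 2 * (N + 1) = 2 * N + 1 + 1 by ring, sum_range_succ, sum_range_succ, ih,
      sum_range_succ, sum_range_succ]
    ring

theorem dot_dirac0 (m : ℕ) (g : ℕ → ℝ) : dot m dirac0 g = g 0 := by
  simp [dot, dirac0]

theorem dot_unifEven (m : ℕ) (g : ℕ → ℝ) :
    dot m (unifEven m) g = (∑ i ∈ range (m + 1), g (2 * i)) / (m + 1) := by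
  rw [dot, sum_range_two_mul, sum_div]
  rw [sum_eq_zero (s := range (m + 1)) (f := fun i => unifEven m (2 * i + 1) * g (2 * i + 1)),
    add_zero]
  · refine sum_congr rfl fun i hi => ?_
    rw [mem_range] at hi
    rw [unifEven, if_pos ⟨even_two_mul i, by omega⟩]; ring
  · intro i _
    rw [unifEven, if_neg (by simp [parity_simps]), zero_mul]

theorem dot_unifOdd_of_le {m M : ℕ} (hm : m ≤ M + 1) (g : ℕ → ℝ) :
    dot M (unifOdd m) g = (∑ i ∈ range m, g (2 * i + 1)) / m := by
  rw [dot, sum_range_two_mul, sum_div]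
  rw [sum_eq_zero (s := range (M + 1)) (f := fun i => unifOdd m (2 * i) * g (2 * i)), zero_add]
  · rw [← sum_subset (range_subset_range.2 hm)]
    · refine sum_congr rfl fun i hi => ?_
      rw [mem_range] at hi
      rw [unifOdd, if_pos ⟨odd_two_mul_add_one i, by omega⟩]; ring
    · intro i _ hi
      rw [mem_range, not_lt] at hi
      rw [unifOdd, if_neg (by omega), zero_mul]
  · intro i _
    rw [unifOdd, if_neg (by simp [parity_simps]), zero_mul]

/-- Each even number below `x` contributes `1` and a tie contributes `1 / 2`, so every unit of `x +
1` is worth `1 / 2` until the range is exhausted. -/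
theorem sum_winReal_even (x N : ℕ) :
    ∑ i ∈ range N, winReal x (2 * i) = (min (x + 1) (2 * N) : ℕ) / 2 := by
  induction N with
  | zero => simp
  | succ N ih =>
    rw [sum_range_succ, ih, winReal_eq]
    rcases lt_trichotomy (2 * N) x with h | h | h
    · rw [if_pos h, min_eq_right (by omega), min_eq_right (by omega)]; push_cast; ring
    · rw [if_neg h.not_lt, if_pos h.symm, min_eq_right (by omega), min_eq_left (by omega), ← h]
      push_cast; ring
    · rw [if_neg h.not_gt, if_neg h.ne, min_eq_left (by omega), min_eq_left (by omega)]; simp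

theorem sum_winReal_odd (x N : ℕ) :
    ∑ i ∈ range N, winReal x (2 * i + 1) = (min x (2 * N) : ℕ) / 2 := by
  induction N with
  | zero => simp
  | succ N ih =>
    rw [sum_range_succ, ih, winReal_eq]
    rcases lt_trichotomy (2 * N + 1) x with h | h | h
    · rw [if_pos h, min_eq_right (by omega), min_eq_right (by omega)]; push_cast; ring
    · rw [if_neg h.not_lt, if_pos h.symm, min_eq_right (by omega), min_eq_left (by omega), ← h]
      push_cast; ring
    · rw [if_neg h.not_gt, if_neg h.ne, min_eq_left (by omega), min_eq_left (by omega)]; simp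

theorem dot_dirac0_winReal_le (m x : ℕ) : dot m dirac0 (winReal x) ≤ 1 := by
  rw [dot_dirac0, winReal_eq]; split_ifs <;> norm_num

theorem dot_unifEven_winReal_le (m x : ℕ) :
    dot m (unifEven m) (winReal x) ≤ (x + 1) / (2 * (m + 1)) := by
  rw [dot_unifEven, sum_winReal_even, div_div]
  gcongr
  exact_mod_cast min_le_left _ _

theorem dot_unifOdd_winReal_le {m M : ℕ} (hm : m ≤ M + 1) (x : ℕ) :
    dot M (unifOdd m) (winReal x) ≤ x / (2 * m) := by
  rw [dot_unifOdd_of_le hm, sum_winReal_odd, div_div]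
  gcongr
  exact_mod_cast min_le_left _ _

theorem dot_unifEven_id (m : ℕ) : dot m (unifEven m) (fun k => k) = m := by
  have : ∀ N : ℕ, ∑ i ∈ range N, ((2 * i : ℕ) : ℝ) = N * (N - 1) := by
    intro N
    induction N with
    | zero => simp
    | succ N ih => rw [sum_range_succ, ih]; push_cast; ring
  rw [dot_unifEven, this]
  push_cast
  field_simp
  ring

theorem dot_unifOdd_id {m M : ℕ} (hm : m ≤ M + 1) : dot M (unifOdd m) (fun k => k) = m := by
  have : ∀ N : ℕ, ∑ i ∈ range N, ((2 * i + 1 : ℕ) : ℝ) = N * N := by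
    intro N
    induction N with
    | zero => simp
    | succ N ih => rw [sum_range_succ, ih]; push_cast; ring
  rw [dot_unifOdd_of_le hm, this, mul_self_div_self]

theorem unifEven_eq_zero {m k : ℕ} (hk : 2 * (m + 1) ≤ k) : unifEven m k = 0 := by
  rw [unifEven, if_neg (by omega)]

theorem unifOdd_eq_zero {m k : ℕ} (hk : 2 * m ≤ k) : unifOdd m k = 0 := by
  rw [unifOdd, if_neg (by omega)]

theorem lottoA_eq_zero {TA TB k : ℕ} (s : ℝ) (hk : 2 * (TA / n + 1) ≤ k) :
    lottoA n TA TB s k = 0 := by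
  have hk' : 2 * (TA / n) ≤ k := by omega
  simp only [lottoA]
  split_ifs <;> simp [mix, unifEven_eq_zero hk, unifOdd_eq_zero hk, unifOdd_eq_zero hk']

theorem lottoB_eq_zero {TA TB k : ℕ} (t : ℝ) (hk : 2 * (TA / n + 1) ≤ k) :
    lottoB n TA TB t k = 0 := by
  have hk0 : k ≠ 0 := (lt_of_lt_of_le (by positivity) hk).ne'
  have hk' : 2 * (TA / n) ≤ k := by omega
  simp only [lottoB]
  split_ifs <;> simp [mix, unifEven_eq_zero hk, unifOdd_eq_zero hk, dirac0, hk0,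
    unifOdd_eq_zero hk']

/-! ### The table solves the Lotto game -/

theorem Admissible.dot_lottoA_id (h : Admissible n TA TB) (s : ℝ) :
    dot (TA / n) (lottoA n TA TB s) (fun k => k) = (TA : ℝ) / n := by
  obtain ⟨m, r, hm, rfl, hr⟩ := h.exists_eq
  have hn := h.two_le
  have hn0 : (n : ℝ) ≠ 0 := by positivity
  have e : ((m * n + r : ℕ) : ℝ) / n = m + r / n := by rw [← excess_div m r hn]; ring
  simp only [lottoA, hm, excess_div m r hn]
  rw [e]
  split_ifs with h1 h2 h3 h4
  · obtain rfl : r = 0 := by omega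
    rw [dot_mix, dot_unifEven_id, dot_unifOdd_id (by omega)]
    push_cast; ring
  · obtain rfl : r = 0 := by omega
    rw [dot_unifOdd_id (by omega)]; simp
  · rw [dot_mix, dot_unifEven_id, dot_unifOdd_id (by omega)]
    push_cast; ring
  · rw [dot_mix, dot_mix, dot_unifEven_id, dot_unifOdd_id (by omega), dot_unifOdd_id (by omega)]
    push_cast; ring
  · rw [dot_mix, dot_unifOdd_id (by omega), dot_unifOdd_id (by omega)]
    push_cast; ring

theorem Admissible.dot_lottoB_id (h : Admissible n TA TB) (t : ℝ) :
    dot (TA / n) (lottoB n TA TB t) (fun k => k) = (TB : ℝ) / n := by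
  obtain ⟨m, r, hm, rfl, hr⟩ := h.exists_eq
  have hn := h.two_le
  have hle := h.le
  have hn0 : (n : ℝ) ≠ 0 := by positivity
  simp only [lottoB, hm]
  split_ifs with h1 h2 h3 h4
  · rw [dot_mix, dot_unifEven_id, dot_unifOdd_id (by omega), h2, h1]
    push_cast; field_simp; ring
  · have hm0 : (m : ℝ) ≠ 0 := by
      rintro h0
      obtain rfl : m = 0 := by exact_mod_cast h0
      omega
    rw [dot_mix, dot_mix, dot_dirac0, dot_unifEven_id, dot_unifOdd_id (by omega)]
    push_cast; field_simp; ring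
  · rw [dot_mix, dot_unifEven_id, dot_unifOdd_id (by omega)]
    push_cast; ring
  · rw [dot_unifEven_id, h4]
    push_cast; field_simp
  · have hm0 : (m : ℝ) ≠ 0 := by
      rintro h0
      obtain rfl : m = 0 := by exact_mod_cast h0
      omega
    rw [dot_mix, dot_dirac0, dot_unifEven_id]
    push_cast; field_simp; ring

/-- The winning probability of `x` units against `μ` is at most `c + d x`. -/
def AffineBound (m : ℕ) (μ : ℕ → ℝ) (c d : ℝ) : Prop :=
  0 ≤ c ∧ 0 ≤ d ∧ ∀ x : ℕ, dot m μ (winReal x) ≤ c + d * x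

theorem AffineBound.mix {m : ℕ} {μ ν : ℕ → ℝ} {c d c' d' θ : ℝ} (h : AffineBound m μ c d)
    (h' : AffineBound m ν c' d') (h0 : 0 ≤ θ) (h1 : θ ≤ 1) :
    AffineBound m (mix θ μ ν) ((1 - θ) * c + θ * c') ((1 - θ) * d + θ * d') := by
  have h2 : 0 ≤ 1 - θ := by linarith
  refine ⟨add_nonneg (mul_nonneg h2 h.1) (mul_nonneg h0 h'.1),
    add_nonneg (mul_nonneg h2 h.2.1) (mul_nonneg h0 h'.2.1), fun x => ?_⟩
  rw [dot_mix]
  have := mul_le_mul_of_nonneg_left (h.2.2 x) h2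
  have := mul_le_mul_of_nonneg_left (h'.2.2 x) h0
  linarith

theorem affineBound_dirac0 (m : ℕ) : AffineBound m dirac0 1 0 :=
  ⟨zero_le_one, le_rfl, fun x => by simpa using dot_dirac0_winReal_le m x⟩

theorem affineBound_unifEven (m : ℕ) :
    AffineBound m (unifEven m) (1 / (2 * (m + 1))) (1 / (2 * (m + 1))) :=
  ⟨by positivity, by positivity, fun x => (dot_unifEven_winReal_le m x).trans_eq (by ring)⟩

/-- For `m = 0` the function `unifOdd 0` vanishes and the slope is `1 / 0 = 0`. -/
theorem affineBound_unifOdd (m : ℕ) : AffineBound m (unifOdd m) 0 (1 / (2 * m)) :=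
  ⟨le_rfl, by positivity, fun x => (dot_unifOdd_winReal_le (by omega) x).trans_eq (by ring)⟩

theorem affineBound_unifOdd_succ (m : ℕ) :
    AffineBound m (unifOdd (m + 1)) 0 (1 / (2 * (m + 1))) :=
  ⟨le_rfl, by positivity, fun x => (dot_unifOdd_winReal_le le_rfl x).trans_eq (by push_cast; ring)⟩

theorem Admissible.exists_affineBound (h : Admissible n TA TB) {s t : ℝ} (hs : IsWeight (TA / n) s)
    (ht : IsWeight (TA / n) t) : ∃ c d c' d', AffineBound (TA / n) (lottoA n TA TB s) c d ∧
      AffineBound (TA / n) (lottoB n TA TB t) c' d' ∧ (n * c + d * TB) + (n * c' + d' * TA) = n := by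
  obtain ⟨m, r, hm, rfl, hr⟩ := h.exists_eq
  have hn := h.two_le
  have hle := h.le
  rw [hm] at hs ht ⊢
  obtain ⟨s0, s1, sm⟩ := hs
  obtain ⟨t0, t1, tm⟩ := ht
  have hn0 : (n : ℝ) ≠ 0 := by positivity
  have hr1 : (r : ℝ) / n ≤ 1 := by
    rw [div_le_one (by positivity)]; exact_mod_cast hr.le
  have hr0 : (0 : ℝ) ≤ r / n := by positivity
  have E := affineBound_unifEven m
  have O := affineBound_unifOdd m
  have O' := affineBound_unifOdd_succ m
  have Z := affineBound_dirac0 m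
  have pos : ∀ {T : ℕ}, T < m * n → (m : ℝ) ≠ 0 := by
    rintro T hT h0
    obtain rfl : m = 0 := by exact_mod_cast h0
    omega
  have quot : ∀ {T : ℕ}, T < m * n → 0 ≤ (T : ℝ) / n / m ∧ (T : ℝ) / n / m ≤ 1 := by
    intro T hT
    refine ⟨by positivity, ?_⟩
    have := (Nat.cast_nonneg m).lt_of_ne (pos hT).symm
    rw [div_div, div_le_one (by positivity), mul_comm]
    exact_mod_cast hT.le
  simp only [lottoA, lottoB, hm, excess_div m r hn]
  split_ifs with h1 h2 h3 h4
  · obtain rfl : r = 0 := by omega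
    subst h2
    refine ⟨_, _, _, _, E.mix O s0 s1, E.mix O t0 t1, ?_⟩
    -- For `m = 0` the odd part has no mass, and the bounds add up to `n` only because its weight is
    -- then `0`.
    rcases Nat.eq_zero_or_pos m with rfl | hm0
    · rw [sm rfl, tm rfl]; norm_num; ring
    · push_cast; field_simp; ring
  · obtain rfl : r = 0 := by omega
    have hlt : TB < m * n := by omega
    have hm0 := pos hlt
    refine ⟨_, _, _, _, O, Z.mix (E.mix O t0 t1) (quot hlt).1 (quot hlt).2, ?_⟩
    push_cast; field_simp; ring
  · obtain ⟨q, rfl⟩ := Nat.exists_eq_add_of_le h3.le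
    rw [excess_div m q hn]
    have hq1 : (q : ℝ) / n ≤ 1 := by
      rw [div_le_one (by positivity)]; exact_mod_cast (by omega : q ≤ n)
    refine ⟨_, _, _, _, E.mix O' hr0 hr1, E.mix O' (by positivity) hq1, ?_⟩
    push_cast; field_simp; ring
  · subst h4
    refine ⟨_, _, _, _, (E.mix O s0 s1).mix O' hr0 hr1, E, ?_⟩
    rcases Nat.eq_zero_or_pos m with rfl | hm0
    · rw [sm rfl]; push_cast; field_simp; ring
    · push_cast; field_simp; ring
  · have hlt : TB < m * n := by omega
    have hm0 := pos hlt
    refine ⟨_, _, _, _, O.mix O' hr0 hr1, Z.mix E (quot hlt).1 (quot hlt).2, ?_⟩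
    push_cast; field_simp; ring

/-- Strategies with the marginals of the table guarantee complementary values in the Lotto game. -/
theorem Admissible.exists_value (h : Admissible n TA TB) {s t : ℝ} (hs : IsWeight (TA / n) s)
    (ht : IsWeight (TA / n) t) {σ τ : Strategy n} (hσ : HasMarginals σ (lottoA n TA TB s))
    (hτ : HasMarginals τ (lottoB n TA TB t)) : ∃ v w : ℝ≥0∞, v ≠ ∞ ∧ w ≠ ∞ ∧ v + w ≤ n ∧
      (∀ σ' ∈ lotto n TA, expPayoff σ' τ ≤ v) ∧ ∀ τ' ∈ lotto n TB, expPayoff τ' σ ≤ w := by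
  obtain ⟨c, d, c', d', ⟨hc, hd, hA⟩, ⟨hc', hd', hB⟩, hsum⟩ := h.exists_affineBound hs ht
  refine ⟨_, _, ENNReal.ofReal_ne_top, ENNReal.ofReal_ne_top, ?_,
    fun σ' hσ' => expPayoff_le_of_affine hτ (fun k => lottoB_eq_zero t) hc' hd' hB hσ',
    fun τ' hτ' => expPayoff_le_of_affine hσ (fun k => lottoA_eq_zero s) hc hd hA hτ'⟩
  rw [← ENNReal.ofReal_add (by positivity) (by positivity), add_comm, hsum, ENNReal.ofReal_natCast]

theorem Admissible.isOptimal_lotto (h : Admissible n TA TB) {s t : ℝ} (hs : IsWeight (TA / n) s)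
    (ht : IsWeight (TA / n) t) {σ τ : Strategy n} (hσ : HasMarginals σ (lottoA n TA TB s))
    (hτ : HasMarginals τ (lottoB n TA TB t)) : IsOptimal (lotto n TA) (lotto n TB) σ ∧
      IsOptimal (lotto n TB) (lotto n TA) τ ∧ IsNash (lotto n TA) (lotto n TB) σ τ := by
  obtain ⟨v, w, hv, hw, hvw, hA, hB⟩ := h.exists_value hs ht hσ hτ
  have hn : n ≠ 0 := by have := h.two_le; omega
  have hσ' := mem_lotto_of_dot hn hσ (fun k => lottoA_eq_zero s) (h.dot_lottoA_id s)
  have hτ' := mem_lotto_of_dot hn hτ (fun k => lottoB_eq_zero t) (h.dot_lottoB_id t)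
  exact ⟨isOptimal_of_saddle hw hσ' hτ' hA hB hvw,
    isOptimal_of_saddle hv hτ' hσ' hB hA (by rwa [add_comm]),
    isNash_of_saddle hv hw hσ' hτ' hA hB hvw⟩

theorem Admissible.isOptimal_blotto (h : Admissible n TA TB) {s t : ℝ} (hs : IsWeight (TA / n) s)
    (ht : IsWeight (TA / n) t) {σ τ : Strategy n} (hσ : HasMarginals σ (lottoA n TA TB s))
    (hτ : HasMarginals τ (lottoB n TA TB t)) (hσ' : σ ∈ blotto n TA) (hτ' : τ ∈ blotto n TB) :
    IsOptimal (blotto n TA) (blotto n TB) σ ∧ IsOptimal (blotto n TB) (blotto n TA) τ ∧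
      IsNash (blotto n TA) (blotto n TB) σ τ := by
  obtain ⟨v, w, hv, hw, hvw, hA, hB⟩ := h.exists_value hs ht hσ hτ
  have hA' : ∀ σ' ∈ blotto n TA, expPayoff σ' τ ≤ v := fun σ' h' => hA σ' (blotto_subset_lotto _ _ h')
  have hB' : ∀ τ' ∈ blotto n TB, expPayoff τ' σ ≤ w := fun τ' h' => hB τ' (blotto_subset_lotto _ _ h')
  exact ⟨isOptimal_of_saddle hw hσ' hτ' hA' hB' hvw,
    isOptimal_of_saddle hv hτ' hσ' hB' hA' (by rwa [add_comm]),
    isNash_of_saddle hv hw hσ' hτ' hA' hB' hvw⟩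

/-! ### Couplings with the marginals of the table -/

theorem IsJointMix.mem_blotto {T : ℕ} {μ : ℕ → ℝ} {σ : Strategy n} (h : IsJointMix T μ σ) :
    σ ∈ blotto n T := fun x hx => (h.2 x hx).le

theorem RatMix.exists_isJointMix {T : ℕ} {μ : ℕ → ℝ} (hn : n ≠ 0) (h : RatMix n T μ) :
    ∃ σ : Strategy n, IsJointMix T μ σ := by
  obtain ⟨L, -, hL, hmix⟩ := h.exists_list hn
  exact ⟨_, hmix⟩

/-- Real weights are out of reach of rational convex combinations, so the mixing is done on the
strategies themselves: a biased coin selects one of the two couplings. -/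
theorem IsJointMix.exists_mix {T : ℕ} {μ ν : ℕ → ℝ} {σ τ : Strategy n} (hσ : IsJointMix T μ σ)
    (hτ : IsJointMix T ν τ) {θ : ℝ} (h0 : 0 ≤ θ) (h1 : θ ≤ 1) :
    ∃ ρ : Strategy n, IsJointMix T (mix θ μ ν) ρ := by
  let w : Bool → ℝ≥0∞ := fun b => ENNReal.ofReal (cond b θ (1 - θ))
  have hw : ∑ b, w b = 1 := by
    rw [Fintype.sum_bool]
    simp only [w, cond_true, cond_false]
    rw [← ENNReal.ofReal_add h0 (by linarith), add_sub_cancel, ENNReal.ofReal_one]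
  refine ⟨(PMF.ofFintype w hw).bind fun b => cond b τ σ, fun i k => ?_, fun x hx => ?_⟩
  · rw [PMF.map_bind, PMF.bind_apply, tsum_bool, PMF.ofFintype_apply, PMF.ofFintype_apply]
    simp only [w, cond_false, cond_true]
    rw [ENNReal.toReal_add (ENNReal.mul_ne_top ENNReal.ofReal_ne_top (PMF.apply_ne_top _ _))
      (ENNReal.mul_ne_top ENNReal.ofReal_ne_top (PMF.apply_ne_top _ _)), ENNReal.toReal_mul,
      ENNReal.toReal_mul, hσ.1, hτ.1, mix, ENNReal.toReal_ofReal (by linarith),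
      ENNReal.toReal_ofReal h0]
  · rw [PMF.mem_support_bind_iff] at hx
    obtain ⟨b, -, hx⟩ := hx
    cases b
    exacts [hσ.2 x hx, hτ.2 x hx]

theorem Admissible.ratMix_lottoA (h : Admissible n TA TB) {s : ℚ} (hs : IsWeight (TA / n) s) :
    RatMix n TA (lottoA n TA TB s) := by
  rcases Nat.eq_zero_or_pos (TA / n) with hm | hm
  · rw [hs.2.2 hm]; exact h.ratMix_lottoA_zero
  · rw [lottoA_eq_mix]
    exact h.ratMix_lottoA_zero.combo (h.ratMix_lottoA_one hm) (by exact_mod_cast hs.1)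
      (by exact_mod_cast hs.2.1)

theorem Admissible.exists_isJointMix_lottoA (h : Admissible n TA TB) {s : ℝ}
    (hs : IsWeight (TA / n) s) : ∃ σ : Strategy n, IsJointMix TA (lottoA n TA TB s) σ := by
  have hn : n ≠ 0 := by have := h.two_le; omega
  obtain ⟨σ, hσ⟩ := h.ratMix_lottoA_zero.exists_isJointMix hn
  rcases Nat.eq_zero_or_pos (TA / n) with hm | hm
  · rw [hs.2.2 hm]; exact ⟨σ, hσ⟩
  · obtain ⟨τ, hτ⟩ := (h.ratMix_lottoA_one hm).exists_isJointMix hn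
    rw [lottoA_eq_mix]
    exact hσ.exists_mix hτ hs.1 hs.2.1

theorem le_maxWeightB {t : ℝ} (ht : IsWeight (TA / n) t)
    (ht' : TB = TA ∨ t ≤ ((TA / n : ℕ) : ℝ) / (2 * ((TA / n : ℕ) : ℝ) + 1)) :
    t ≤ maxWeightB n TA TB := by
  rw [maxWeightB]
  split_ifs with h
  · simpa using ht.2.1
  · push_cast; exact ht'.resolve_left h

theorem Admissible.ratMix_lottoB (h : Admissible n TA TB) {t : ℚ} (ht : IsWeight (TA / n) t)
    (ht' : TB = TA ∨ (t : ℝ) ≤ ((TA / n : ℕ) : ℝ) / (2 * ((TA / n : ℕ) : ℝ) + 1)) :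
    RatMix n TB (lottoB n TA TB t) := by
  rcases Nat.eq_zero_or_pos (TA / n) with hm | hm
  · rw [ht.2.2 hm]; exact h.ratMix_lottoB_zero
  · have hpos := maxWeightB_pos (TB := TB) hm
    have hle : t ≤ maxWeightB n TA TB := by exact_mod_cast le_maxWeightB ht ht'
    have h0 : 0 ≤ t := by exact_mod_cast ht.1
    rw [lottoB_eq_mix (u := maxWeightB n TA TB) _ _ _ (by exact_mod_cast hpos.ne')]
    exact_mod_cast h.ratMix_lottoB_zero.combo (h.ratMix_lottoB_max hm)
      (θ := t / maxWeightB n TA TB) (div_nonneg h0 hpos.le) ((div_le_one hpos).2 hle)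

theorem Admissible.exists_isJointMix_lottoB (h : Admissible n TA TB) {t : ℝ}
    (ht : IsWeight (TA / n) t)
    (ht' : TB = TA ∨ t ≤ ((TA / n : ℕ) : ℝ) / (2 * ((TA / n : ℕ) : ℝ) + 1)) :
    ∃ τ : Strategy n, IsJointMix TB (lottoB n TA TB t) τ := by
  have hn : n ≠ 0 := by have := h.two_le; omega
  obtain ⟨σ, hσ⟩ := h.ratMix_lottoB_zero.exists_isJointMix hn
  rcases Nat.eq_zero_or_pos (TA / n) with hm | hm
  · rw [ht.2.2 hm]; exact ⟨σ, hσ⟩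
  · obtain ⟨τ, hτ⟩ := (h.ratMix_lottoB_max hm).exists_isJointMix hn
    have hpos : (0 : ℝ) < maxWeightB n TA TB := by exact_mod_cast maxWeightB_pos (TB := TB) hm
    rw [lottoB_eq_mix (u := maxWeightB n TA TB) _ _ _ hpos.ne']
    exact hσ.exists_mix hτ (div_nonneg ht.1 hpos.le) ((div_le_one hpos).2 (le_maxWeightB ht ht'))

theorem isWeight_zero (m : ℕ) : IsWeight m 0 := ⟨le_rfl, zero_le_one, fun _ => rfl⟩

/-- The saddle point needs some partner inside the Blotto game; the coupling with weight `0`, which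
is always allowed, serves. -/
theorem Admissible.isOptimal_blotto_left (h : Admissible n TA TB) {s : ℝ}
    (hs : IsWeight (TA / n) s) {σ : Strategy n} (hσ : HasMarginals σ (lottoA n TA TB s))
    (hσ' : σ ∈ blotto n TA) : IsOptimal (blotto n TA) (blotto n TB) σ := by
  obtain ⟨τ, hτ⟩ := h.exists_isJointMix_lottoB (isWeight_zero _) (Or.inr (by positivity))
  exact (h.isOptimal_blotto hs (isWeight_zero _) hσ hτ.1 hσ' hτ.mem_blotto).1

theorem Admissible.isOptimal_blotto_right (h : Admissible n TA TB) {t : ℝ}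
    (ht : IsWeight (TA / n) t) {τ : Strategy n} (hτ : HasMarginals τ (lottoB n TA TB t))
    (hτ' : τ ∈ blotto n TB) : IsOptimal (blotto n TB) (blotto n TA) τ := by
  obtain ⟨σ, hσ⟩ := h.exists_isJointMix_lottoA (isWeight_zero _)
  exact (h.isOptimal_blotto (isWeight_zero _) ht hσ.1 hτ hσ.mem_blotto hτ').2.1

/-! ### Computability -/

section Computability

variable {α β : Type*} [Primcodable α] [Primcodable β]

/-- Unbounded search for a solution of a primitive recursive relation. -/
theorem exists_computable_of_primrecRel {P : α → Prop} {R : α → β → Prop}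
    (hP : PrimrecPred P) (hR : PrimrecRel R) (b₀ : β) (h : ∀ a, P a → ∃ b, R a b) :
    ∃ f : α → β, Computable f ∧ ∀ a, P a → R a (f a) := by
  classical
  -- Inputs violating `P` accept every value, so the search stops everywhere and the function is
  -- total.
  have hQ : PrimrecPred fun x : (α × ℕ) × β => ¬ P x.1.1 ∨ R x.1.1 x.2 :=
    (hP.comp (Primrec.fst.comp Primrec.fst)).not.or
      (hR.comp (Primrec.fst.comp Primrec.fst) Primrec.snd)
  let g : α → ℕ → Option β := fun a k =>
    (Encodable.decode k).bind fun b => if ¬ P a ∨ R a b then some b else none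
  have hg : Primrec₂ g :=
    Primrec.option_bind (Primrec.decode.comp Primrec.snd)
      (Primrec.ite hQ (Primrec.option_some.comp Primrec.snd) (Primrec.const none))
  have dom : ∀ a, (Nat.rfindOpt (g a)).Dom := by
    intro a
    obtain ⟨b, hb⟩ : ∃ b, ¬ P a ∨ R a b := by
      by_cases ha : P a
      · obtain ⟨b, hb⟩ := h a ha
        exact ⟨b, Or.inr hb⟩
      · exact ⟨b₀, Or.inl ha⟩
    rw [Nat.rfindOpt_dom]
    exact ⟨Encodable.encode b, b, by simp [g, hb]⟩
  refine ⟨fun a => (Nat.rfindOpt (g a)).get (dom a), ?_, fun a ha => ?_⟩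
  · exact (Partrec.rfindOpt hg.to_comp).of_eq fun a => (Part.some_get (dom a)).symm
  · obtain ⟨k, hk⟩ := Nat.rfindOpt_spec (Part.get_mem (dom a))
    simp only [g, Option.mem_def, Option.bind_eq_some_iff, Option.ite_none_right_eq_some] at hk
    obtain ⟨b, -, hb, hb'⟩ := hk
    have := hb.resolve_left (not_not.2 ha)
    rwa [Option.some_inj.1 hb'] at this

/-- Rational valued functions given by primitive recursive numerators and denominators. -/
def PrimrecReal (f : α → ℝ) : Prop :=
  ∃ a b d : α → ℕ, Primrec a ∧ Primrec b ∧ Primrec d ∧ ∀ x, d x ≠ 0 ∧ f x = ((a x : ℝ) - b x) / d x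

namespace PrimrecReal

variable {f g : α → ℝ}

theorem natCast {f : α → ℕ} (hf : Primrec f) : PrimrecReal fun x => (f x : ℝ) :=
  ⟨f, fun _ => 0, fun _ => 1, hf, .const 0, .const 1, fun x => by simp⟩

theorem zero : PrimrecReal fun _ : α => (0 : ℝ) := by
  simpa using natCast (α := α) (.const 0)

theorem one : PrimrecReal fun _ : α => (1 : ℝ) := by
  simpa using natCast (α := α) (.const 1)

theorem sub (hf : PrimrecReal f) (hg : PrimrecReal g) : PrimrecReal fun x => f x - g x := by
  obtain ⟨a, b, d, ha, hb, hd, h⟩ := hf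
  obtain ⟨a', b', d', ha', hb', hd', h'⟩ := hg
  have mul {u v : α → ℕ} (hu : Primrec u) (hv : Primrec v) : Primrec fun x => u x * v x :=
    Primrec.nat_mul.comp hu hv
  refine ⟨fun x => a x * d' x + b' x * d x, fun x => b x * d' x + a' x * d x,
    fun x => d x * d' x, Primrec.nat_add.comp (mul ha hd') (mul hb' hd),
    Primrec.nat_add.comp (mul hb hd') (mul ha' hd), mul hd hd', fun x => ?_⟩
  obtain ⟨h1, h2⟩ := h x
  obtain ⟨h1', h2'⟩ := h' x
  refine ⟨Nat.mul_ne_zero h1 h1', ?_⟩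
  dsimp only
  rw [h2, h2']
  have : (d x : ℝ) ≠ 0 := by exact_mod_cast h1
  have : (d' x : ℝ) ≠ 0 := by exact_mod_cast h1'
  push_cast; field_simp; ring

theorem add (hf : PrimrecReal f) (hg : PrimrecReal g) : PrimrecReal fun x => f x + g x := by
  simpa using hf.sub (zero.sub hg)

theorem mul (hf : PrimrecReal f) (hg : PrimrecReal g) : PrimrecReal fun x => f x * g x := by
  obtain ⟨a, b, d, ha, hb, hd, h⟩ := hf
  obtain ⟨a', b', d', ha', hb', hd', h'⟩ := hg
  have mul {u v : α → ℕ} (hu : Primrec u) (hv : Primrec v) : Primrec fun x => u x * v x :=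
    Primrec.nat_mul.comp hu hv
  refine ⟨fun x => a x * a' x + b x * b' x, fun x => a x * b' x + b x * a' x,
    fun x => d x * d' x, Primrec.nat_add.comp (mul ha ha') (mul hb hb'),
    Primrec.nat_add.comp (mul ha hb') (mul hb ha'), mul hd hd', fun x => ?_⟩
  obtain ⟨h1, h2⟩ := h x
  obtain ⟨h1', h2'⟩ := h' x
  refine ⟨Nat.mul_ne_zero h1 h1', ?_⟩
  dsimp only
  rw [h2, h2']
  have : (d x : ℝ) ≠ 0 := by exact_mod_cast h1
  have : (d' x : ℝ) ≠ 0 := by exact_mod_cast h1'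
  push_cast; field_simp; ring

theorem ite {c : α → Prop} [DecidablePred c] (hc : PrimrecPred c) (hf : PrimrecReal f)
    (hg : PrimrecReal g) : PrimrecReal fun x => if c x then f x else g x := by
  obtain ⟨a, b, d, ha, hb, hd, h⟩ := hf
  obtain ⟨a', b', d', ha', hb', hd', h'⟩ := hg
  refine ⟨_, _, _, Primrec.ite hc ha ha', Primrec.ite hc hb hb', Primrec.ite hc hd hd', fun x => ?_⟩
  dsimp only
  split_ifs
  exacts [h x, h' x]

theorem inv_natCast {f : α → ℕ} (hf : Primrec f) : PrimrecReal fun x => (f x : ℝ)⁻¹ := by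
  refine ⟨fun x => if f x = 0 then 0 else 1, fun _ => 0, fun x => if f x = 0 then 1 else f x,
    Primrec.ite (Primrec.eq.comp hf (.const 0)) (.const 0) (.const 1), .const 0,
    Primrec.ite (Primrec.eq.comp hf (.const 0)) (.const 1) hf, fun x => ?_⟩
  dsimp only
  split_ifs with h <;> simp [h]

theorem div_natCast (hf : PrimrecReal f) {g : α → ℕ} (hg : Primrec g) :
    PrimrecReal fun x => f x / g x := by
  simpa only [div_eq_mul_inv] using hf.mul (inv_natCast hg)

theorem comp {f : β → ℝ} (hf : PrimrecReal f) {g : α → β} (hg : Primrec g) :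
    PrimrecReal fun x => f (g x) := by
  obtain ⟨a, b, d, ha, hb, hd, h⟩ := hf
  exact ⟨_, _, _, ha.comp hg, hb.comp hg, hd.comp hg, fun x => h (g x)⟩

/-- Equality of reals becomes decidable: the difference vanishes exactly when the two natural
numbers in its numerator agree. -/
theorem eq (hf : PrimrecReal f) (hg : PrimrecReal g) : PrimrecPred fun x => f x = g x := by
  obtain ⟨a, b, d, ha, hb, hd, h⟩ := hf.sub hg
  refine (Primrec.eq.comp ha hb).of_eq fun x => ?_
  obtain ⟨h1, h2⟩ := h x
  dsimp only at h2
  have : (d x : ℝ) ≠ 0 := by exact_mod_cast h1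
  rw [← sub_eq_zero (a := f x), h2, div_eq_zero_iff, or_iff_left this, sub_eq_zero, Nat.cast_inj]

theorem mix {t : α → ℝ} {μ ν : α → ℕ → ℝ} {k : α → ℕ} (ht : PrimrecReal t)
    (hμ : PrimrecReal fun x => μ x (k x)) (hν : PrimrecReal fun x => ν x (k x)) :
    PrimrecReal fun x => mix (t x) (μ x) (ν x) (k x) :=
  ((one.sub ht).mul hμ).add (ht.mul hν)

end PrimrecReal

theorem primrecPred_even {f : α → ℕ} (hf : Primrec f) : PrimrecPred fun x => Even (f x) :=
  (Primrec.eq.comp (Primrec.nat_mod.comp hf (.const 2)) (.const 0)).of_eq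
    fun _ => Nat.even_iff.symm

/-! ### Primitive recursiveness of the table of marginals -/

section Table

variable {k m n TA TB : α → ℕ}

theorem primrecReal_dirac0 (hk : Primrec k) : PrimrecReal fun x => dirac0 (k x) :=
  .ite (Primrec.eq.comp hk (.const 0)) .one .zero

theorem primrecReal_unifEven (hm : Primrec m) (hk : Primrec k) :
    PrimrecReal fun x => unifEven (m x) (k x) := by
  refine .ite ((primrecPred_even hk).and
    (Primrec.nat_le.comp hk (Primrec.nat_mul.comp (.const 2) hm))) ?_ .zero
  simpa using PrimrecReal.one.div_natCast (Primrec.succ.comp hm)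

theorem primrecReal_unifOdd (hm : Primrec m) (hk : Primrec k) :
    PrimrecReal fun x => unifOdd (m x) (k x) :=
  .ite (((primrecPred_even hk).not.of_eq fun _ => Nat.not_even_iff_odd).and
    (Primrec.nat_lt.comp hk (Primrec.nat_mul.comp (.const 2) hm))) (.div_natCast .one hm) .zero

variable {s : α → ℝ}

theorem primrecReal_lottoA (hn : Primrec n) (hA : Primrec TA) (hB : Primrec TB) (hk : Primrec k)
    (hs : PrimrecReal s) : PrimrecReal fun x => lottoA (n x) (TA x) (TB x) (s x) (k x) := by
  have hm := Primrec.nat_div.comp hA hn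
  have hmn := Primrec.nat_mul.comp hm hn
  have hα := ((PrimrecReal.natCast hA).div_natCast hn).sub (.natCast hm)
  have hE := primrecReal_unifEven hm hk
  have hO := primrecReal_unifOdd hm hk
  have hO' := primrecReal_unifOdd (Primrec.succ.comp hm) hk
  have key := PrimrecReal.ite (Primrec.eq.comp hA hmn)
    (.ite (Primrec.eq.comp hB hA) (.mix hs hE hO) hO)
    (.ite (Primrec.nat_lt.comp hmn hB) (.mix hα hE hO')
      (.ite (Primrec.eq.comp hB hmn) (.mix hα (.mix hs hE hO) hO') (.mix hα hO hO')))
  convert key using 2 with x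
  simp only [lottoA]
  split_ifs <;> rfl

theorem primrecReal_lottoB (hn : Primrec n) (hA : Primrec TA) (hB : Primrec TB) (hk : Primrec k)
    (hs : PrimrecReal s) : PrimrecReal fun x => lottoB (n x) (TA x) (TB x) (s x) (k x) := by
  have hm := Primrec.nat_div.comp hA hn
  have hmn := Primrec.nat_mul.comp hm hn
  have hb := (PrimrecReal.natCast hB).div_natCast hn
  have hZ := primrecReal_dirac0 hk
  have hE := primrecReal_unifEven hm hk
  have hO := primrecReal_unifOdd hm hk
  have hO' := primrecReal_unifOdd (Primrec.succ.comp hm) hk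
  have key := PrimrecReal.ite (Primrec.eq.comp hA hmn)
    (.ite (Primrec.eq.comp hB hA) (.mix hs hE hO)
      (.mix (hb.div_natCast hm) (μ := fun _ => dirac0) hZ (.mix hs hE hO)))
    (.ite (Primrec.nat_lt.comp hmn hB) (.mix (hb.sub (.natCast hm)) hE hO')
      (.ite (Primrec.eq.comp hB hmn) hE (.mix (hb.div_natCast hm) (μ := fun _ => dirac0) hZ hE)))
  convert key using 2 with x
  simp only [lottoB]
  split_ifs <;> rfl

end Table

/-- Reduces the condition to finitely many `k`: an entry of a list with sum `T` is at most `T`, and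
`μ` vanishes from `N` on. -/
theorem listIsJointMix_iff_bounded {n T N : ℕ} {μ : ℕ → ℝ} (hμ : ∀ k, N ≤ k → μ k = 0)
    {L : List (List ℕ)} : ListIsJointMix n T μ L ↔ L.length ≠ 0 ∧
      (∀ l ∈ L, l.length = n ∧ l.sum = T) ∧ ∀ i ∈ List.range n, ∀ k ∈ List.range (N + T + 1),
        ((L.filter fun l => l.getD i 0 = k).length : ℝ) / L.length = μ k := by
  rw [listIsJointMix_iff, ne_eq, ne_eq, List.length_eq_zero_iff]
  refine and_congr_right fun hL => and_congr_right fun hs => ?_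
  simp only [List.mem_range, ← List.countP_eq_length_filter]
  refine ⟨fun h i hi k _ => h i hi k, fun h i hi k => ?_⟩
  by_cases hk : k < N + T + 1
  · exact h i hi k hk
  · have : L.countP (fun l => l.getD i 0 = k) = 0 := by
      rw [List.countP_eq_zero]
      intro l hl hlk
      have hlk : l.getD i 0 = k := by simpa using hlk
      obtain ⟨h1, h2⟩ := hs l hl
      have hi' : i < l.length := by omega
      rw [List.getD_eq_getElem _ _ hi'] at hlk
      have := List.le_sum_of_mem (List.getElem_mem hi')
      omega
    rw [this, hμ k (by omega)]
    simp

theorem primrec_list_sum : Primrec (List.sum : List ℕ → ℕ) :=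
  (Primrec.list_foldr .id (.const 0)
    (Primrec.nat_add.comp (Primrec.fst.comp Primrec.snd) (Primrec.snd.comp Primrec.snd)).to₂).of_eq
    fun _ => rfl

theorem primrecPred_forall_range {N : α → ℕ} {p : α × ℕ → Prop} (hN : Primrec N)
    (hp : PrimrecPred p) : PrimrecPred fun a => ∀ k ∈ List.range (N a), p (a, k) := by
  have hp' : PrimrecRel fun (k : ℕ) (a : α) => p (a, k) := hp.comp (Primrec.snd.pair .fst)
  exact hp'.forall_mem_list.comp (Primrec.list_range.comp hN) .id

theorem primrecRel_listIsJointMix {n T N : α → ℕ} {μ : α → ℕ → ℝ} (hn : Primrec n)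
    (hT : Primrec T) (hN : Primrec N) (hμ : PrimrecReal fun x : α × ℕ => μ x.1 x.2)
    (h0 : ∀ a k, N a ≤ k → μ a k = 0) :
    PrimrecRel fun a L => ListIsJointMix (n a) (T a) (μ a) L := by
  have entries : PrimrecRel fun (l : List ℕ) (a : α) => l.length = n a ∧ l.sum = T a :=
    (Primrec.eq.comp (Primrec.list_length.comp .fst) (hn.comp .snd)).and
      (Primrec.eq.comp (primrec_list_sum.comp .fst) (hT.comp .snd))
  have value : PrimrecRel fun (l : List ℕ) (b : ℕ × ℕ) => l.getD b.1 0 = b.2 :=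
    Primrec.eq.comp ((Primrec.list_getD 0).comp .fst (Primrec.fst.comp .snd))
      (Primrec.snd.comp .snd)
  have freq : PrimrecPred fun y : ((α × List (List ℕ)) × ℕ) × ℕ =>
      ((y.1.1.2.filter fun l => l.getD y.1.2 0 = y.2).length : ℝ) / y.1.1.2.length =
        μ y.1.1.1 y.2 := by
    have hL : Primrec fun y : ((α × List (List ℕ)) × ℕ) × ℕ => y.1.1.2 :=
      Primrec.snd.comp (Primrec.fst.comp .fst)
    have hik : Primrec fun y : ((α × List (List ℕ)) × ℕ) × ℕ => (y.1.2, y.2) :=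
      (Primrec.snd.comp .fst).pair .snd
    have hf : Primrec fun y : ((α × List (List ℕ)) × ℕ) × ℕ =>
        (y.1.1.2.filter fun l => l.getD y.1.2 0 = y.2).length :=
      Primrec.list_length.comp (value.listFilter.comp hL hik)
    have hμ' : PrimrecReal fun y : ((α × List (List ℕ)) × ℕ) × ℕ => μ y.1.1.1 y.2 :=
      hμ.comp ((Primrec.fst.comp (Primrec.fst.comp .fst)).pair .snd)
    have hq : PrimrecReal fun y : ((α × List (List ℕ)) × ℕ) × ℕ =>
        ((y.1.1.2.filter fun l => l.getD y.1.2 0 = y.2).length : ℝ) / y.1.1.2.length :=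
      (PrimrecReal.natCast hf).div_natCast (Primrec.list_length.comp hL)
    exact PrimrecReal.eq hq hμ'
  have hb : Primrec fun y : (α × List (List ℕ)) × ℕ => N y.1.1 + T y.1.1 + 1 :=
    Primrec.succ.comp (Primrec.nat_add.comp (hN.comp (Primrec.fst.comp .fst))
      (hT.comp (Primrec.fst.comp .fst)))
  have inner := primrecPred_forall_range hb freq
  have outer := primrecPred_forall_range (hn.comp (Primrec.fst (β := List (List ℕ)))) inner
  have all : PrimrecPred fun x : α × List (List ℕ) =>
      ∀ l ∈ x.2, l.length = n x.1 ∧ l.sum = T x.1 :=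
    entries.forall_mem_list.comp Primrec.snd Primrec.fst
  have ne : PrimrecPred fun x : α × List (List ℕ) => ¬ x.2.length = 0 :=
    (Primrec.eq.comp (Primrec.list_length.comp .snd) (.const 0)).not
  refine PrimrecPred.of_eq (ne.and (all.and outer)) fun x => ?_
  exact (listIsJointMix_iff_bounded (h0 x.1)).symm

end Computability

end DiscreteBlotto

/-! ### Valid inputs and the two algorithms -/

namespace DiscreteBlotto

/-- The inputs for which player `A`'s algorithm has to produce a coupling. -/
def ValidInput (x : ℕ × ℕ × ℕ × ℕ × ℕ) : Prop :=
  (2 ≤ x.1 ∧ x.2.2.1 ≤ x.2.1 ∧ Even x.2.2.1 ∧ (Even x.2.1 ↔ Even x.1) ∧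
    2 * (x.2.1 / x.1) ≤ x.2.2.1) ∧
  0 < x.2.2.2.2 ∧ x.2.2.2.1 ≤ x.2.2.2.2 ∧ (x.2.1 / x.1 = 0 → x.2.2.2.1 = 0)

/-- The additional condition on the weight for player `B`. -/
def ValidWeightB (x : ℕ × ℕ × ℕ × ℕ × ℕ) : Prop :=
  x.2.2.1 = x.2.1 ∨ x.2.2.2.1 * (2 * (x.2.1 / x.1) + 1) ≤ x.2.1 / x.1 * x.2.2.2.2

theorem validInput_iff {n TA TB p q : ℕ} : ValidInput (n, TA, TB, p, q) ↔
    Admissible n TA TB ∧ 0 < q ∧ IsWeight (TA / n) ((p : ℝ) / q) := by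
  constructor
  · rintro ⟨⟨h1, h2, h3, h4, h5⟩, hq, hpq, hm⟩
    refine ⟨⟨h1, h2, h3, h4, h5⟩, hq, by positivity, ?_, fun h => ?_⟩
    · have : (0 : ℝ) < q := by exact_mod_cast hq
      rw [div_le_one this]; exact_mod_cast hpq
    · have : p = 0 := hm h
      simp [this]
  · rintro ⟨h, hq, -, h1, hm⟩
    have hq' : (0 : ℝ) < q := by exact_mod_cast hq
    refine ⟨⟨h.1, h.2, h.3, h.4, h.5⟩, hq, ?_, fun h0 => ?_⟩
    · rw [div_le_one hq'] at h1; exact_mod_cast h1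
    · have := hm h0
      rw [div_eq_zero_iff, or_iff_left hq'.ne'] at this
      exact_mod_cast this

theorem validWeightB_iff {n TA TB p q : ℕ} (hq : 0 < q) : ValidWeightB (n, TA, TB, p, q) ↔
    TB = TA ∨ (p : ℝ) / q ≤ ((TA / n : ℕ) : ℝ) / (2 * ((TA / n : ℕ) : ℝ) + 1) := by
  have hq' : (0 : ℝ) < q := by exact_mod_cast hq
  refine or_congr Iff.rfl ?_
  rw [div_le_div_iff₀ hq' (by positivity)]
  exact_mod_cast Iff.rfl

section Computability

open Primrec

variable {α : Type*} [Primcodable α]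

theorem primrecPred_imp {p q : α → Prop} (hp : PrimrecPred p) (hq : PrimrecPred q) :
    PrimrecPred fun a => p a → q a :=
  (hp.not.or hq).of_eq fun _ => imp_iff_not_or.symm

theorem primrecPred_iff {p q : α → Prop} (hp : PrimrecPred p) (hq : PrimrecPred q) :
    PrimrecPred fun a => (p a ↔ q a) :=
  ((primrecPred_imp hp hq).and (primrecPred_imp hq hp)).of_eq fun _ => iff_iff_implies_and_implies.symm

theorem primrecPred_validInput : PrimrecPred ValidInput := by
  have hA : Primrec fun x : ℕ × ℕ × ℕ × ℕ × ℕ => x.2.1 := fst.comp snd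
  have hB : Primrec fun x : ℕ × ℕ × ℕ × ℕ × ℕ => x.2.2.1 := fst.comp (snd.comp snd)
  have hp : Primrec fun x : ℕ × ℕ × ℕ × ℕ × ℕ => x.2.2.2.1 := fst.comp (snd.comp (snd.comp snd))
  have hq : Primrec fun x : ℕ × ℕ × ℕ × ℕ × ℕ => x.2.2.2.2 := snd.comp (snd.comp (snd.comp snd))
  have hm : Primrec fun x : ℕ × ℕ × ℕ × ℕ × ℕ => x.2.1 / x.1 := nat_div.comp hA fst
  exact ((nat_le.comp (const 2) fst).and ((nat_le.comp hB hA).and ((primrecPred_even hB).and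
    ((primrecPred_iff (primrecPred_even hA) (primrecPred_even fst)).and
      (nat_le.comp (nat_mul.comp (const 2) hm) hB))))).and
    ((nat_lt.comp (const 0) hq).and ((nat_le.comp hp hq).and
      (primrecPred_imp (Primrec.eq.comp hm (const 0)) (Primrec.eq.comp hp (const 0)))))

theorem primrecPred_validWeightB : PrimrecPred ValidWeightB := by
  have hA : Primrec fun x : ℕ × ℕ × ℕ × ℕ × ℕ => x.2.1 := fst.comp snd
  have hB : Primrec fun x : ℕ × ℕ × ℕ × ℕ × ℕ => x.2.2.1 := fst.comp (snd.comp snd)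
  have hp : Primrec fun x : ℕ × ℕ × ℕ × ℕ × ℕ => x.2.2.2.1 := fst.comp (snd.comp (snd.comp snd))
  have hq : Primrec fun x : ℕ × ℕ × ℕ × ℕ × ℕ => x.2.2.2.2 := snd.comp (snd.comp (snd.comp snd))
  have hm : Primrec fun x : ℕ × ℕ × ℕ × ℕ × ℕ => x.2.1 / x.1 := nat_div.comp hA fst
  exact (Primrec.eq.comp hB hA).or (nat_le.comp
    (nat_mul.comp hp (succ.comp (nat_mul.comp (const 2) hm))) (nat_mul.comp hm hq))

theorem exists_algorithmA : ∃ alg : ℕ × ℕ × ℕ × ℕ × ℕ → List (List ℕ), Computable alg ∧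
    ∀ x, ValidInput x → ListIsJointMix x.1 x.2.1
      (lottoA x.1 x.2.1 x.2.2.1 ((x.2.2.2.1 : ℝ) / x.2.2.2.2)) (alg x) := by
  have hA : Primrec fun x : ℕ × ℕ × ℕ × ℕ × ℕ => x.2.1 := fst.comp snd
  have hN : Primrec fun x : ℕ × ℕ × ℕ × ℕ × ℕ => 2 * (x.2.1 / x.1 + 1) :=
    nat_mul.comp (const 2) (succ.comp (nat_div.comp hA fst))
  have hB : Primrec fun x : (ℕ × ℕ × ℕ × ℕ × ℕ) × ℕ => x.1.2.2.1 := fst.comp (snd.comp (snd.comp fst))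
  have hp : Primrec fun x : (ℕ × ℕ × ℕ × ℕ × ℕ) × ℕ => x.1.2.2.2.1 :=
    fst.comp (snd.comp (snd.comp (snd.comp fst)))
  have hq : Primrec fun x : (ℕ × ℕ × ℕ × ℕ × ℕ) × ℕ => x.1.2.2.2.2 :=
    snd.comp (snd.comp (snd.comp (snd.comp fst)))
  refine exists_computable_of_primrecRel primrecPred_validInput
    (primrecRel_listIsJointMix fst hA hN (primrecReal_lottoA (fst.comp fst) (hA.comp fst) hB snd
      ((PrimrecReal.natCast hp).div_natCast hq)) fun x k hk => lottoA_eq_zero _ hk) [] ?_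
  rintro ⟨n, TA, TB, p, q⟩ hx
  obtain ⟨h, hq, hw⟩ := validInput_iff.1 hx
  have := h.two_le
  refine RatMix.exists_list (by omega : n ≠ 0) ?_
  -- The weight has to be the cast of a rational number, since list-valued couplings are available
  -- for rational weights only.
  have e : (p : ℝ) / q = ((p / q : ℚ) : ℝ) := by push_cast; rfl
  dsimp only
  rw [e] at hw ⊢
  exact h.ratMix_lottoA hw

theorem exists_algorithmB : ∃ alg : ℕ × ℕ × ℕ × ℕ × ℕ → List (List ℕ), Computable alg ∧
    ∀ x, ValidInput x ∧ ValidWeightB x → ListIsJointMix x.1 x.2.2.1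
      (lottoB x.1 x.2.1 x.2.2.1 ((x.2.2.2.1 : ℝ) / x.2.2.2.2)) (alg x) := by
  have hA : Primrec fun x : ℕ × ℕ × ℕ × ℕ × ℕ => x.2.1 := fst.comp snd
  have hN : Primrec fun x : ℕ × ℕ × ℕ × ℕ × ℕ => 2 * (x.2.1 / x.1 + 1) :=
    nat_mul.comp (const 2) (succ.comp (nat_div.comp hA fst))
  have hB : Primrec fun x : ℕ × ℕ × ℕ × ℕ × ℕ => x.2.2.1 := fst.comp (snd.comp snd)
  have hp : Primrec fun x : (ℕ × ℕ × ℕ × ℕ × ℕ) × ℕ => x.1.2.2.2.1 :=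
    fst.comp (snd.comp (snd.comp (snd.comp fst)))
  have hq : Primrec fun x : (ℕ × ℕ × ℕ × ℕ × ℕ) × ℕ => x.1.2.2.2.2 :=
    snd.comp (snd.comp (snd.comp (snd.comp fst)))
  refine exists_computable_of_primrecRel (primrecPred_validInput.and primrecPred_validWeightB)
    (primrecRel_listIsJointMix fst hB hN (primrecReal_lottoB (fst.comp fst) (hA.comp fst)
      (hB.comp fst) snd ((PrimrecReal.natCast hp).div_natCast hq)) fun x k hk => lottoB_eq_zero _ hk)
    [] ?_
  rintro ⟨n, TA, TB, p, q⟩ ⟨hx, hx'⟩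
  obtain ⟨h, hq, hw⟩ := validInput_iff.1 hx
  have := h.two_le
  refine RatMix.exists_list (by omega : n ≠ 0) ?_
  have e : (p : ℝ) / q = ((p / q : ℚ) : ℝ) := by push_cast; rfl
  have hx' := (validWeightB_iff hq).1 hx'
  dsimp only
  rw [e] at hw hx' ⊢
  exact h.ratMix_lottoB hw hx'

end Computability

end DiscreteBlotto

open DiscreteBlotto in
theorem mainTheorem12 :
    ∃ algA algB : ℕ × ℕ × ℕ × ℕ × ℕ → List (List ℕ), Computable algA ∧ Computable algB ∧
    ∀ n TA TB : ℕ, 2 ≤ n → TB ≤ TA → Even TB → (Even TA ↔ Even n) → 2 * (TA / n) ≤ TB →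
      -- the marginals of the table are solutions of the Lotto game and of the Blotto game
      (∀ s t : ℝ, IsWeight (TA / n) s → IsWeight (TA / n) t →
        ∀ σ τ : Strategy n, HasMarginals σ (lottoA n TA TB s) → HasMarginals τ (lottoB n TA TB t) →
          (IsOptimal (lotto n TA) (lotto n TB) σ ∧ IsOptimal (lotto n TB) (lotto n TA) τ ∧
            IsNash (lotto n TA) (lotto n TB) σ τ) ∧
          (σ ∈ blotto n TA → IsOptimal (blotto n TA) (blotto n TB) σ) ∧
          (τ ∈ blotto n TB → IsOptimal (blotto n TB) (blotto n TA) τ) ∧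
          (σ ∈ blotto n TA → τ ∈ blotto n TB → IsNash (blotto n TA) (blotto n TB) σ τ)) ∧
      -- they can be coupled into strategies of the Blotto game
      (∀ s : ℝ, IsWeight (TA / n) s →
        ∃ σ : Strategy n, IsJointMix TA (lottoA n TA TB s) σ ∧
          IsOptimal (blotto n TA) (blotto n TB) σ) ∧
      (∀ t : ℝ, IsWeight (TA / n) t →
        TB = TA ∨ t ≤ ((TA / n : ℕ) : ℝ) / (2 * ((TA / n : ℕ) : ℝ) + 1) →
        ∃ τ : Strategy n, IsJointMix TB (lottoB n TA TB t) τ ∧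
          IsOptimal (blotto n TB) (blotto n TA) τ) ∧
      -- such couplings are computed by an algorithm, for every rational weight `p / q`
      (∀ p q : ℕ, 0 < q → IsWeight (TA / n) ((p : ℝ) / q) →
        ListIsJointMix n TA (lottoA n TA TB ((p : ℝ) / q)) (algA (n, TA, TB, p, q)) ∧
        (TB = TA ∨ (p : ℝ) / q ≤ ((TA / n : ℕ) : ℝ) / (2 * ((TA / n : ℕ) : ℝ) + 1) →
          ListIsJointMix n TB (lottoB n TA TB ((p : ℝ) / q)) (algB (n, TA, TB, p, q)))) := by
  obtain ⟨algA, hA, hA'⟩ := exists_algorithmA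
  obtain ⟨algB, hB, hB'⟩ := exists_algorithmB
  refine ⟨algA, algB, hA, hB, fun n TA TB h1 h2 h3 h4 h5 => ?_⟩
  have h : Admissible n TA TB := ⟨h1, h2, h3, h4, h5⟩
  refine ⟨fun s t hs ht σ τ hσ hτ => ⟨h.isOptimal_lotto hs ht hσ hτ,
    h.isOptimal_blotto_left hs hσ, h.isOptimal_blotto_right ht hτ,
    fun hσ' hτ' => (h.isOptimal_blotto hs ht hσ hτ hσ' hτ').2.2⟩, fun s hs => ?_,
    fun t ht ht' => ?_, fun p q hq hw => ?_⟩
  · obtain ⟨σ, hσ⟩ := h.exists_isJointMix_lottoA hs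
    exact ⟨σ, hσ, h.isOptimal_blotto_left hs hσ.1 hσ.mem_blotto⟩
  · obtain ⟨τ, hτ⟩ := h.exists_isJointMix_lottoB ht ht'
    exact ⟨τ, hτ, h.isOptimal_blotto_right ht hτ.1 hτ.mem_blotto⟩
  · have hx := validInput_iff.2 ⟨h, hq, hw⟩
    exact ⟨hA' _ hx, fun hp => hB' _ ⟨hx, (validWeightB_iff hq).2 hp⟩⟩
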